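/- **Definitions.** A relational structure $R=(E,(\rho_i)_{i\in I})$ is a set $E$ with a (possibly infinite) family of relations $\rho_i$ on $E$, each of finite arity. For $A\subseteq E$, let $R_{\restriction A}$ be the structure induced on $A$. The age $\mathcal A(R)$ is the set of isomorphism types of the structures $R_{\restriction A}$ with $A\subseteq E$ finite, and the profile $\varphi_R(n)$ is the number of isomorphism types of the $R_{\restriction A}$ with $|A|=n$. A monomorphic decomposition of $R$ is a partition of $E$ into nonempty blocks such that $R_{\restriction A}\cong R_{\restriction A'}$ whenever $A,A'\subseteq E$ are finite and $|A\cap B|=|A'\cap B|$ for every block $B$. A monomorphic part of $R$ is a set $V\subseteq E$ such that $R_{\restriction A}\cong R_{\restriction A'}$ whenever $A,A'\subseteq E$ are finite, $|A|=|A'|$ and $A\setminus V=A'\setminus V$. A monomorphic component of $R$ is a monomorphic part that is maximal for inclusion. **Theorem (Pouzet, Thiéry).** Let $R$ be a relational structure on an infinite set $E$ that admits a monomorphic decomposition into finitely many blocks, and let $k$ be the number of infinite monomorphic components of $R$. Then: 1. The monomorphic components of $R$ are finite in number, they form a monomorphic decomposition of $R$, each block of any monomorphic decomposition of $R$ is contained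 in a monomorphic component, and $k\ge 1$. 2. The age of $R$ is a rational language: let $X$ be the finite set of monomorphic components, and say that a word $w$ over the alphabet $X$ codes the isomorphism type of $R_{\restriction A}$, for $A\subseteq E$ finite, if each letter $C\in X$ occurs exactly $|A\cap C|$ times in $w$. Then there is a rational (that is, regular) language $W\subseteq X^*$ such that each word of $W$ codes exactly one element of $\mathcal A(R)$ and each element of $\mathcal A(R)$ is coded by exactly one word of $W$. 3. Each $\varphi_R(n)$ is finite, and there is $P\in\mathbb Z[Z]$ with $P(1)\neq 0$ such that $$\sum_{n\ge 0}\varphi_R(n)Z^n=\frac{P(Z)}{(1-Z)(1-Z^2)\cdots(1-Z^k)}.$$ 4. In particular there is a real number $a>0$ such that $\varphi_R(n)/n^{k-1}\to a$ as $n\to\infty$. -/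

import Mathlib

open Polynomial PowerSeries Filter Topology

noncomputable section

namespace RelationalStructure

open FirstOrder

/- A relational structure on the domain `E` is an `L`-structure on `E` for a first-order language
`L` that has relation symbols only (an arbitrary family of symbols, each with its own arity). -/

/-- The substructure induced on a subset `A` of the domain. -/
def induced (L : Language) [L.IsRelational] {E : Type*} [L.Structure E] (A : Set E) :
    L.Substructure E where
  carrier := A
  fun_mem := fun f => isEmptyElim f

/-- Two finite subsets are equivalent when the structures they induce are isomorphic. -/
def isoSetoid (L : Language) [L.IsRelational] (E : Type*) [L.Structure E] :
    Setoid (Finset E) where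
  r A B := Nonempty (induced L (A : Set E) ≃[L] induced L (B : Set E))
  iseqv :=
    { refl := fun _ => ⟨Language.Equiv.refl L _⟩
      symm := fun ⟨f⟩ => ⟨f.symm⟩
      trans := fun ⟨f⟩ ⟨g⟩ => ⟨g.comp f⟩ }

/-- The age: the set of isomorphism types of the finite restrictions of the structure. -/
def Age (L : Language) [L.IsRelational] (E : Type*) [L.Structure E] : Type _ :=
  Quotient (isoSetoid L E)

/-- The isomorphism type of the restriction to a finite subset `A`. -/
def isoType (L : Language) [L.IsRelational] {E : Type*} [L.Structure E] (A : Finset E) : Age L E :=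
  Quotient.mk (isoSetoid L E) A

/-- The isomorphism types of the restrictions to the `n`-element subsets. -/
def typesOfSize (L : Language) [L.IsRelational] (E : Type*) [L.Structure E] (n : ℕ) :
    Set (Age L E) :=
  isoType L '' {A : Finset E | A.card = n}

/-- The profile (meaningful when each `typesOfSize L E n` is finite). -/
def profile (L : Language) [L.IsRelational] (E : Type*) [L.Structure E] (n : ℕ) : ℕ :=
  (typesOfSize L E n).ncard

/-- A monomorphic decomposition: a partition `P` of the domain into nonempty blocks such that two
finite subsets that meet each block in the same number of elements induce isomorphic structures. -/
def IsMonomorphicDecomposition (L : Language) [L.IsRelational] {E : Type*} [L.Structure E]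
    (P : Set (Set E)) : Prop :=
  Setoid.IsPartition P ∧
    ∀ A A' : Finset E, (∀ B ∈ P, ((A : Set E) ∩ B).ncard = ((A' : Set E) ∩ B).ncard) →
      isoType L A = isoType L A'

/-- A monomorphic part: a set `V` such that two finite subsets of the domain with the same number
of elements and the same trace outside `V` induce isomorphic structures. -/
def IsMonomorphicPart (L : Language) [L.IsRelational] {E : Type*} [L.Structure E]
    (V : Set E) : Prop :=
  ∀ A A' : Finset E, A.card = A'.card → (A : Set E) \ V = (A' : Set E) \ V →
    isoType L A = isoType L A'

/-- A monomorphic component: a maximal monomorphic part. -/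
def IsMonomorphicComponent (L : Language) [L.IsRelational] {E : Type*} [L.Structure E]
    (V : Set E) : Prop :=
  Maximal (IsMonomorphicPart L) V

/-- The monomorphic components, as a type (used as an alphabet). -/
abbrev Component (L : Language) [L.IsRelational] (E : Type*) [L.Structure E] : Type _ :=
  {C : Set E // IsMonomorphicComponent L C}

open Classical in
/-- A word `w` on the alphabet of the monomorphic components codes the isomorphism type `τ` if
`τ` is the type of a finite set having, in each component `C`, as many elements as `w` has
letters `C`. -/
def Codes {L : Language} [L.IsRelational] {E : Type*} [L.Structure E]
    (w : List (Component L E)) (τ : Age L E) : Prop :=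
  ∃ A : Finset E, (∀ C : Component L E, w.count C = ((A : Set E) ∩ C.1).ncard) ∧
    isoType L A = τ

/-- The age is a rational language: some rational (regular) language on the alphabet of the
monomorphic components is, through the coding of types by words, in bijection with the age. -/
def AgeIsRational (L : Language) [L.IsRelational] (E : Type*) [L.Structure E] : Prop :=
  ∃ W : _root_.Language (Component L E), W.IsRegular ∧
    (∀ w ∈ W, ∃! τ : Age L E, Codes w τ) ∧
    (∀ τ : Age L E, ∃! w : List (Component L E), w ∈ W ∧ Codes w τ)

end RelationalStructure

end

/-! Call two elements interchangeable when either can replace the other in every finite set without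
changing its isomorphism type. The monomorphic components are exactly the classes of this relation,
so a type is determined by the vector counting the elements of a set in each component. The problem
is to choose one vector per type regularly enough to be counted. The argument needs only that an
isomorphism restricts to subsets (`IsHereditary`).

An isomorphism preserves interchangeability computed inside the two sets, which may be coarser than
the trace of the components. Hence `exists_isGoodCell_cover`: finitely many cells, each made of a
fixed base and arbitrarily many additional elements in certain infinite components (the directions),
cover all types, and in each cell the direction classes are intrinsically the classes with at least
`N` elements. An isomorphism from a set of one cell to a set of a cell of lower or equal level
carries directions injectively to directions (`exists_direction_map`).

Order the cells by level and the vectors of a cell lexicographically, and keep the least code of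
each type. The key fact is `IsLeading.bump`: least codes remain least when 1 is added to all entries
that are at least `h`, because a layer can be removed from a competitor along an isomorphism.

Every vector is uniquely a positive combination of indicators of a strictly decreasing chain of
sets, and adding one of these indicators is such a bump. By Dickson's lemma the least codes form a
finite disjoint union of translates of free monoids spanned by chains (`isDecomposable_of_bump`).
Such a piece is coded without ambiguity by a language of the form $u\,w_1^*\cdots w_r^*$, and its
series is $Z^d/\prod(1-Z^{|S|})$ with distinct sizes, at most $k$ because the layers consist of
infinite components. Over the common denominator, a piece contributes 1 to $P(1)$ if it has $k$
layers and 0 otherwise. Widely separated numbers of elements in the infinite components force a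
piece with $k$ layers (`exists_length_le`), so $P(1)>0$, and the growth follows by induction on the
number of factors. -/

noncomputable section

namespace RelationalStructure

/-! ### Interchangeable elements -/

section Typing

open Classical

variable {E α : Type*}

/-- A function on finite sets (thought of as an isomorphism type) is hereditary if two finite sets
with the same value are related by a bijection that preserves the values of all subsets. -/
def IsHereditary (t : Finset E → α) : Prop :=
  ∀ A B, t A = t B → ∃ f : E → E, Set.InjOn f A ∧ A.image f = B ∧ ∀ F ⊆ A, t F = t (F.image f)

/-- Two elements are interchangeable in `D` if they can replace each other in every finite subset
of `D` without changing its type. -/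
def Interchangeable (t : Finset E → α) (D : Set E) (x y : E) : Prop :=
  ∀ F : Finset E, (F : Set E) ⊆ D → x ∉ F → y ∉ F → t (insert x F) = t (insert y F)

variable {t : Finset E → α} {D D' : Set E} {x y z : E}

theorem IsHereditary.card_eq (ht : IsHereditary t) {A B : Finset E} (h : t A = t B) :
    A.card = B.card := by
  obtain ⟨f, hf, rfl, -⟩ := ht A B h
  exact (Finset.card_image_of_injOn hf).symm

theorem Interchangeable.refl (t : Finset E → α) (D : Set E) (x : E) : Interchangeable t D x x :=
  fun _ _ _ _ => rfl

theorem Interchangeable.symm (h : Interchangeable t D x y) : Interchangeable t D y x :=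
  fun F hF hy hx => (h F hF hx hy).symm

theorem Interchangeable.mono (h : Interchangeable t D x y) (hD : D' ⊆ D) :
    Interchangeable t D' x y :=
  fun F hF hx hy => h F (hF.trans hD) hx hy

/-- If `F` contains the middle element `y`, the exchange of `x` for `z` is made in two moves around
`F.erase y`. The sets tested then contain `x` or `z`, hence the membership in `D`. -/
theorem Interchangeable.trans (hx : x ∈ D) (hz : z ∈ D)
    (h₁ : Interchangeable t D x y) (h₂ : Interchangeable t D y z) : Interchangeable t D x z := by
  intro F hF hxF hzF
  by_cases hxz : x = z
  · rw [hxz]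
  by_cases hyF : y ∈ F
  · set G := F.erase y with hG
    have hFG : F = insert y G := (Finset.insert_erase hyF).symm
    have hGD : (G : Set E) ⊆ D := fun u hu => hF (Finset.erase_subset _ _ hu)
    have hxG : x ∉ G := fun h => hxF (Finset.erase_subset _ _ h)
    have hzG : z ∉ G := fun h => hzF (Finset.erase_subset _ _ h)
    have hyG : y ∉ G := Finset.notMem_erase y F
    have hxy : x ≠ y := fun h => hxF (h ▸ hyF)
    have hzy : z ≠ y := fun h => hzF (h ▸ hyF)
    have e₁ := h₂ (insert x G) (by
      intro u hu
      rcases Finset.mem_insert.1 (Finset.mem_coe.1 hu) with rfl | hu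
      exacts [hx, hGD hu]) (by simp [hxy.symm, hyG]) (by simp [Ne.symm hxz, hzG])
    have e₂ := h₁ (insert z G) (by
      intro u hu
      rcases Finset.mem_insert.1 (Finset.mem_coe.1 hu) with rfl | hu
      exacts [hz, hGD hu]) (by simp [hxz, hxG]) (by simp [hzy.symm, hyG])
    rw [hFG, Finset.insert_comm x y, e₁, Finset.insert_comm z x, e₂, Finset.insert_comm y z]
  · exact (h₁ F hF hxF hyF).trans (h₂ F hF hyF hzF)

theorem Interchangeable.congr_left (hx : x ∈ D) (hy : y ∈ D) (hz : z ∈ D)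
    (h : Interchangeable t D x y) : Interchangeable t D z x ↔ Interchangeable t D z y :=
  ⟨fun h' => h'.trans hz hy h, fun h' => h'.trans hz hx h.symm⟩

/-- Two finite subsets of `D` that meet each class of interchangeable elements in the same number
of elements have the same type. -/
theorem eq_of_card_filter_interchangeable {A B : Finset E} (hA : (A : Set E) ⊆ D)
    (hB : (B : Set E) ⊆ D)
    (h : ∀ x ∈ D, (A.filter (Interchangeable t D x)).card
      = (B.filter (Interchangeable t D x)).card) : t A = t B := by
  -- Exchanging an element of `A \ B` for an interchangeable one of `B \ A` lowers this cardinal by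
  -- one.
  induction hn : (A \ B).card generalizing A with
  | zero =>
    have hAB : A ⊆ B := Finset.sdiff_eq_empty_iff_subset.1 (Finset.card_eq_zero.1 hn)
    by_cases hBA : B ⊆ A
    · rw [hAB.antisymm hBA]
    · obtain ⟨b, hb, hbA⟩ := Finset.not_subset.1 hBA
      have hlt : (A.filter (Interchangeable t D b)).card
          < (B.filter (Interchangeable t D b)).card := by
        refine Finset.card_lt_card (Finset.ssubset_iff_of_subset
          (Finset.filter_subset_filter _ hAB) |>.2 ⟨b, ?_, ?_⟩)
        · simp [hb, Interchangeable.refl]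
        · simp [hbA]
      exact absurd (h b (hB hb)) hlt.ne
  | succ n ih =>
    obtain ⟨x, hx⟩ : (A \ B).Nonempty := Finset.card_pos.1 (by omega)
    obtain ⟨hxA, hxB⟩ := Finset.mem_sdiff.1 hx
    have hxD := hA hxA
    -- Otherwise the class of `x` in `B` would be contained in its class in `A` and miss `x`, so it
    -- would be smaller.
    obtain ⟨y, hyB, hyA⟩ : ∃ y ∈ B.filter (Interchangeable t D x), y ∉ A := by
      by_contra! hcon
      have hlt : (B.filter (Interchangeable t D x)).card
          < (A.filter (Interchangeable t D x)).card := by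
        refine Finset.card_lt_card ((Finset.ssubset_iff_of_subset ?_).2 ⟨x, ?_, ?_⟩)
        · intro y hy
          exact Finset.mem_filter.2 ⟨hcon y hy, (Finset.mem_filter.1 hy).2⟩
        · simp [hxA, Interchangeable.refl]
        · simp [hxB]
      exact absurd (h x hxD) hlt.ne'
    obtain ⟨hyB, hxy⟩ := Finset.mem_filter.1 hyB
    have hyD := hB hyB
    have hstep : t A = t (insert y (A.erase x)) := by
      conv_lhs => rw [← Finset.insert_erase hxA]
      exact hxy _ (fun u hu => hA (Finset.erase_subset _ _ hu)) (Finset.notMem_erase x A)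
        (fun hu => hyA (Finset.erase_subset _ _ hu))
    rw [hstep]
    refine ih ?_ ?_ ?_
    · intro u hu
      rcases Finset.mem_insert.1 (Finset.mem_coe.1 hu) with rfl | hu
      exacts [hyD, hA (Finset.erase_subset _ _ hu)]
    · intro z hz
      rw [← h z hz]
      have hcongr := hxy.congr_left hxD hyD hz
      by_cases hzx : Interchangeable t D z x
      · rw [Finset.filter_insert, if_pos (hcongr.1 hzx), Finset.card_insert_of_notMem
          (by simp [hyA]), Finset.filter_erase,
          Finset.card_erase_add_one (by simp [hxA, hzx])]
      · rw [Finset.filter_insert, if_neg (fun h' => hzx (hcongr.2 h')), Finset.filter_erase,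
          Finset.erase_eq_of_notMem (by simp [hzx])]
    · have : insert y (A.erase x) \ B = (A \ B).erase x := by
        ext u
        simp only [Finset.mem_sdiff, Finset.mem_insert, Finset.mem_erase]
        constructor
        · rintro ⟨rfl | ⟨h1, h2⟩, h3⟩
          exacts [absurd hyB h3, ⟨h1, h2, h3⟩]
        · rintro ⟨h1, h2, h3⟩
          exact ⟨Or.inr ⟨h1, h2⟩, h3⟩
      rw [this, Finset.card_erase_of_mem hx]
      omega

/-- The image of a pair of interchangeable elements under a type preserving map. -/
theorem Interchangeable.image {A : Finset E} {f : E → E}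
    (hft : ∀ F ⊆ A, t F = t (F.image f)) (hx : x ∈ A) (hy : y ∈ A)
    (h : Interchangeable t A x y) : Interchangeable t (A.image f) (f x) (f y) := by
  intro F hF hxF hyF
  obtain ⟨G, hGA, rfl⟩ := Finset.subset_image_iff.1 (Finset.coe_subset.1 hF)
  have hxG : x ∉ G := fun h' => hxF (Finset.mem_image_of_mem f h')
  have hyG : y ∉ G := fun h' => hyF (Finset.mem_image_of_mem f h')
  rw [← Finset.image_insert, ← Finset.image_insert, ← hft _ (Finset.insert_subset hx hGA),
    ← hft _ (Finset.insert_subset hy hGA)]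
  exact h G (Finset.coe_subset.2 hGA) hxG hyG

/-- Interchangeability inside a finite set is intrinsic to its type, unlike interchangeability in
the whole domain. This is why the relation is taken relative to `D`. -/
theorem interchangeable_image_iff {A : Finset E} {f : E → E} (hf : Set.InjOn f A)
    (hft : ∀ F ⊆ A, t F = t (F.image f)) (hx : x ∈ A) (hy : y ∈ A) :
    Interchangeable t (A.image f) (f x) (f y) ↔ Interchangeable t A x y := by
  refine ⟨fun h F hF hxF hyF => ?_, fun h => h.image hft hx hy⟩
  have hFA : F ⊆ A := Finset.coe_subset.1 hF
  have hmem : ∀ u ∈ A, u ∉ F → f u ∉ F.image f := by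
    intro u hu huF huF'
    obtain ⟨v, hv, hvu⟩ := Finset.mem_image.1 huF'
    exact huF (hf (hFA hv) hu hvu ▸ hv)
  rw [hft _ (Finset.insert_subset hx hFA), hft _ (Finset.insert_subset hy hFA),
    Finset.image_insert, Finset.image_insert]
  exact h _ (Finset.coe_subset.2 (Finset.image_subset_image hFA)) (hmem x hx hxF) (hmem y hy hyF)

/-- The size of the class of an element is preserved by type preserving maps. -/
theorem card_filter_interchangeable_image {A : Finset E} {f : E → E} (hf : Set.InjOn f A)
    (hft : ∀ F ⊆ A, t F = t (F.image f)) (hx : x ∈ A) :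
    ((A.image f).filter (Interchangeable t (A.image f) (f x))).card
      = (A.filter (Interchangeable t A x)).card := by
  rw [← Finset.card_image_of_injOn (f := f) (s := A.filter (Interchangeable t A x))
    (hf.mono (Finset.coe_subset.2 (Finset.filter_subset _ _)))]
  congr 1
  ext u
  simp only [Finset.mem_filter, Finset.mem_image]
  constructor
  · rintro ⟨⟨v, hv, rfl⟩, h⟩
    exact ⟨v, ⟨hv, (interchangeable_image_iff hf hft hx hv).1 (by simpa using h)⟩, rfl⟩
  · rintro ⟨v, ⟨hv, h⟩, rfl⟩
    exact ⟨⟨v, hv, rfl⟩, by simpa using (interchangeable_image_iff hf hft hx hv).2 h⟩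

/-! ### Vectors of numbers of elements in the fibers -/

section Vec

variable {X : Type*} {π : E → X}

/-- The number of elements of a finite set in each fiber. -/
def vec (π : E → X) (A : Finset E) (c : X) : ℕ := (A.filter (fun x => π x = c)).card

theorem vec_union {A B : Finset E} (h : Disjoint A B) :
    vec π (A ∪ B) = vec π A + vec π B := by
  ext c
  rw [vec, Finset.filter_union, Finset.card_union_of_disjoint
    (Finset.disjoint_filter_filter h)]
  rfl

theorem vec_sdiff_add {A B : Finset E} (h : B ⊆ A) : vec π (A \ B) + vec π B = vec π A := by
  rw [← vec_union Finset.sdiff_disjoint, Finset.sdiff_union_of_subset h]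

theorem sum_vec [Fintype X] (A : Finset E) : ∑ c, vec π A c = A.card :=
  (Finset.card_eq_sum_card_fiberwise (f := π) (t := Finset.univ) (by simp)).symm

theorem vec_pos {A : Finset E} (hx : x ∈ A) : 0 < vec π A (π x) :=
  Finset.card_pos.2 ⟨x, by simp [hx]⟩

theorem exists_mem_of_vec_pos {A : Finset E} {c : X} (h : 0 < vec π A c) :
    ∃ x ∈ A, π x = c := by
  obtain ⟨x, hx⟩ := Finset.card_pos.1 h
  exact ⟨x, Finset.mem_filter.1 hx⟩

/-- The fibers of `π` are the interchangeability classes of the whole domain; `componentOf` will be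
the map used. -/
theorem eq_of_vec_eq (hπ : ∀ x y, π x = π y ↔ Interchangeable t Set.univ x y)
    {A B : Finset E} (h : vec π A = vec π B) : t A = t B := by
  refine eq_of_card_filter_interchangeable (D := Set.univ) (Set.subset_univ _)
    (Set.subset_univ _) fun x _ => ?_
  have : ∀ y, Interchangeable t Set.univ x y ↔ π y = π x := fun y => by rw [← hπ, eq_comm]
  simp only [this]
  exact congrFun h (π x)

theorem vec_biUnion [Fintype X] {T : X → Finset E} (hT : ∀ c, ∀ x ∈ T c, π x = c) (c : X) :
    vec π (Finset.univ.biUnion T) c = (T c).card := by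
  rw [vec]
  congr 1
  ext x
  simp only [Finset.mem_filter, Finset.mem_biUnion, Finset.mem_univ, true_and]
  constructor
  · rintro ⟨⟨c', hx⟩, rfl⟩
    rwa [hT _ _ hx]
  · intro hx
    exact ⟨⟨c, hx⟩, hT _ _ hx⟩

theorem exists_disjoint_vec_eq [Fintype X] (A : Finset E) (e : X → ℕ)
    (he : ∀ c, e c ≠ 0 → (π ⁻¹' {c}).Infinite) :
    ∃ T : Finset E, Disjoint A T ∧ vec π T = e := by
  have : ∀ c, ∃ T : Finset E, (∀ x ∈ T, π x = c) ∧ (∀ x ∈ T, x ∉ A) ∧ T.card = e c := by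
    intro c
    by_cases hc : e c = 0
    · exact ⟨∅, by simp [hc]⟩
    · obtain ⟨T, hT, hcard⟩ := ((he c hc).sdiff A.finite_toSet).exists_subset_card_eq (e c)
      exact ⟨T, fun x hx => (hT hx).1, fun x hx => (hT hx).2, hcard⟩
  choose T h₁ h₂ h₃ using this
  refine ⟨Finset.univ.biUnion T, ?_, ?_⟩
  · rw [Finset.disjoint_right]
    intro x hx
    obtain ⟨c, -, hx⟩ := Finset.mem_biUnion.1 hx
    exact h₂ c x hx
  · ext c
    rw [vec_biUnion h₁, h₃]

theorem exists_superset_vec_eq [Fintype X] (A : Finset E) (e : X → ℕ)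
    (he : ∀ c, e c ≠ 0 → (π ⁻¹' {c}).Infinite) :
    ∃ B : Finset E, A ⊆ B ∧ vec π B = vec π A + e := by
  obtain ⟨T, hT, rfl⟩ := exists_disjoint_vec_eq A e he
  exact ⟨A ∪ T, Finset.subset_union_left, vec_union hT⟩

theorem exists_subset_vec_eq [Fintype X] {A : Finset E} {d : X → ℕ} (hd : d ≤ vec π A) :
    ∃ B ⊆ A, vec π B = d := by
  have : ∀ c, ∃ T ⊆ A.filter (fun x => π x = c), T.card = d c :=
    fun c => Finset.exists_subset_card_eq (hd c)
  choose T h₁ h₂ using this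
  have h₃ : ∀ c, ∀ x ∈ T c, π x = c := fun c x hx => (Finset.mem_filter.1 (h₁ c hx)).2
  refine ⟨Finset.univ.biUnion T, ?_, ?_⟩
  · exact Finset.biUnion_subset.2 fun c _ => (h₁ c).trans (Finset.filter_subset _ _)
  · ext c
    rw [vec_biUnion h₃, h₂]

end Vec

end Typing

/-! ### Cells and their refinement into good cells -/

section Cells

open Classical

variable {E α X : Type*} {t : Finset E → α} {π : E → X}

/-- Replacing a set of pairwise interchangeable elements by another one of the same size. -/
theorem union_eq_union_of_interchangeable {D : Set E} {G P Q : Finset E} {x : E}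
    (hG : (G : Set E) ⊆ D) (hP : (P : Set E) ⊆ D) (hQ : (Q : Set E) ⊆ D) (hx : x ∈ D)
    (hGP : Disjoint G P) (hGQ : Disjoint G Q) (hcard : P.card = Q.card)
    (hPx : ∀ p ∈ P, Interchangeable t D x p) (hQx : ∀ p ∈ Q, Interchangeable t D x p) :
    t (G ∪ P) = t (G ∪ Q) := by
  refine eq_of_card_filter_interchangeable (D := D)
    (by rw [Finset.coe_union]; exact Set.union_subset hG hP)
    (by rw [Finset.coe_union]; exact Set.union_subset hG hQ) fun z hz => ?_
  have key : ∀ R : Finset E, (R : Set E) ⊆ D → (∀ p ∈ R, Interchangeable t D x p) →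
      R.filter (Interchangeable t D z) = if Interchangeable t D z x then R else ∅ := by
    intro R hR hRx
    split_ifs with hzx
    · exact Finset.filter_true_of_mem fun p hp => hzx.trans hz (hR hp) (hRx p hp)
    · exact Finset.filter_false_of_mem fun p hp h => hzx (h.trans hz hx (hRx p hp).symm)
  rw [Finset.filter_union, Finset.filter_union, Finset.card_union_of_disjoint
    (Finset.disjoint_filter_filter hGP), Finset.card_union_of_disjoint
    (Finset.disjoint_filter_filter hGQ), key P hP hPx, key Q hQ hQx]
  split_ifs <;> simp [hcard]

/-- The largest set whose finite subsets are described by the cell of base `U` and directions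
`M`. -/
def cellDomain (π : E → X) (U : Finset E) (M : Finset X) : Set E := ↑U ∪ π ⁻¹' ↑M

/-- The types of the finite sets that have as many elements as `U` in each fiber, except for
additional elements in the fibers of the elements of `M`. -/
def cellTypes (t : Finset E → α) (π : E → X) (U : Finset E) (M : Finset X) : Set α :=
  {τ | ∃ (A : Finset E) (a : X → ℕ), (∀ c ∉ M, a c = 0) ∧ vec π A = vec π U + a ∧ t A = τ}

/-- A cell is good of level `N` if the fibers of its directions belong to distinct classes of
interchangeable elements, which can be recognized in the base, have exactly `N` elements in the
base, and are the only classes with at least `N` elements in the base. -/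
structure IsGoodCell (t : Finset E → α) (π : E → X) (U : Finset E) (M : Finset X) (N : ℕ) :
    Prop where
  infinite : ∀ c ∈ M, (π ⁻¹' {c}).Infinite
  meets : ∀ c ∈ M, ∃ x ∈ U, π x = c
  separated : ∀ x y, π x ∈ M → π y ∈ M → Interchangeable t (cellDomain π U M) x y → π x = π y
  fat : ∀ x ∈ U, ∀ y ∈ U, Interchangeable t (U : Set E) x y →
    Interchangeable t (cellDomain π U M) x y
  card_eq : ∀ x ∈ U, π x ∈ M → (U.filter (Interchangeable t (cellDomain π U M) x)).card = N
  exists_of_le : ∀ x ∈ U, N ≤ (U.filter (Interchangeable t (cellDomain π U M) x)).card →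
    ∃ y, π y ∈ M ∧ Interchangeable t (cellDomain π U M) x y

theorem vec_eq_zero_of_notMem {T : Finset E} {M : Finset X} (hT : ∀ x ∈ T, π x ∈ M) {c : X}
    (hc : c ∉ M) : vec π T c = 0 := by
  rw [vec, Finset.card_eq_zero]
  exact Finset.filter_false_of_mem fun x hx h => hc (h ▸ hT x hx)

theorem mem_of_vec_eq_zero {T : Finset E} {M : Finset X} (hT : ∀ c ∉ M, vec π T c = 0) :
    ∀ x ∈ T, π x ∈ M := by
  intro x hx
  by_contra h
  exact (vec_pos hx).ne' (hT _ h)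

variable [Fintype X]

variable (hπ : ∀ x y, π x = π y ↔ Interchangeable t Set.univ x y)

include hπ in
/-- If two fibers of directions are interchangeable, one of the directions can be dropped. -/
theorem cellTypes_subset_erase {U : Finset E} {M : Finset X}
    (hM : ∀ c ∈ M, (π ⁻¹' {c}).Infinite) {x y : E} (hx : π x ∈ M)
    (hne : π x ≠ π y) (hxy : Interchangeable t (cellDomain π U M) x y) :
    cellTypes t π U M ⊆ cellTypes t π U (M.erase (π y)) := by
  rintro τ ⟨A, a, ha, hA, rfl⟩
  have hinf : ∀ c, a c ≠ 0 → (π ⁻¹' {c}).Infinite := fun c hc =>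
    hM c (by_contra fun h => hc (ha c h))
  obtain ⟨T, hUT, hT⟩ := exists_disjoint_vec_eq (π := π) U a hinf
  have hTM : ∀ z ∈ T, π z ∈ M := mem_of_vec_eq_zero (fun c hc => by rw [hT, ha c hc])
  -- The additional elements in the fiber of `y` are traded for as many new elements `Q` of the
  -- fiber of `x`. The base is left untouched.
  set P := T.filter (fun z => π z = π y) with hP
  obtain ⟨Q, hQdisj, hQ⟩ := exists_disjoint_vec_eq (π := π) (U ∪ T)
    (Pi.single (π x) P.card) (by
      intro c hc
      by_cases h : c = π x
      · rw [h]; exact hM _ hx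
      · simp [h] at hc)
  have hQx : ∀ z ∈ Q, π z = π x := by
    intro z hz
    by_contra h
    have := vec_pos (π := π) hz
    rw [hQ, Pi.single_eq_of_ne h] at this
    exact this.false
  have hQcard : Q.card = P.card := by
    rw [← sum_vec (π := π), hQ]
    simp
  have hG : U ∪ T = (U ∪ (T \ P)) ∪ P := by
    rw [Finset.union_assoc, Finset.sdiff_union_of_subset (Finset.filter_subset _ _)]
  have hDU : (U : Set E) ⊆ cellDomain π U M := Set.subset_union_left
  have hDM : ∀ z, π z ∈ M → z ∈ cellDomain π U M := fun z hz => Or.inr hz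
  have hUP : Disjoint (U ∪ (T \ P)) P := by
    rw [Finset.disjoint_union_left]
    exact ⟨hUT.mono_right (Finset.filter_subset _ _), Finset.sdiff_disjoint⟩
  have hUQ : Disjoint (U ∪ (T \ P)) Q :=
    hQdisj.mono_left (Finset.union_subset_union_right Finset.sdiff_subset)
  have huniv : ∀ z w, π z = π w → Interchangeable t (cellDomain π U M) z w := fun z w h =>
    ((hπ z w).1 h).mono (Set.subset_univ _)
  have hTA : t A = t (U ∪ T) := eq_of_vec_eq hπ (by rw [hA, vec_union hUT, hT])
  have hstep : t (U ∪ T) = t ((U ∪ (T \ P)) ∪ Q) := by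
    rw [hG]
    refine union_eq_union_of_interchangeable (D := cellDomain π U M) (x := x) ?_ ?_ ?_
      (hDM x hx) hUP hUQ hQcard.symm ?_ ?_
    · intro z hz
      rcases Finset.mem_union.1 (Finset.mem_coe.1 hz) with hz | hz
      exacts [hDU hz, hDM z (hTM z (Finset.sdiff_subset hz))]
    · exact fun z hz => hDM z (hTM z (Finset.filter_subset _ _ hz))
    · exact fun z hz => hDM z (by rw [hQx z hz]; exact hx)
    · intro z hz
      exact hxy.trans (hDM x hx) (hDM z (hTM z (Finset.filter_subset _ _ hz)))
        (huniv _ _ (Finset.mem_filter.1 hz).2.symm)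
    · exact fun z hz => huniv _ _ (hQx z hz).symm
  refine ⟨(U ∪ (T \ P)) ∪ Q, vec π ((T \ P) ∪ Q), ?_, ?_, by rw [← hstep, hTA]⟩
  · intro c hc
    refine vec_eq_zero_of_notMem ?_ hc
    intro z hz
    rcases Finset.mem_union.1 hz with hz | hz
    · obtain ⟨hzT, hzP⟩ := Finset.mem_sdiff.1 hz
      refine Finset.mem_erase.2 ⟨fun h => hzP (Finset.mem_filter.2 ⟨hzT, h⟩), hTM z hzT⟩
    · rw [hQx z hz]
      exact Finset.mem_erase.2 ⟨hne, hx⟩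
  · rw [Finset.union_assoc, vec_union]
    rw [Finset.disjoint_union_right]
    exact ⟨hUT.mono_right Finset.sdiff_subset,
      hQdisj.mono_left Finset.subset_union_left⟩

/-- Finitely many pairs of elements that are not interchangeable in `D` are not interchangeable in
some finite subset of `D`. -/
theorem exists_finset_interchangeable {D : Set E} {U : Finset E} (hU : (U : Set E) ⊆ D) :
    ∃ V : Finset E, U ⊆ V ∧ (V : Set E) ⊆ D ∧
      ∀ x ∈ U, ∀ y ∈ U, ∀ D' : Set E, ↑V ⊆ D' → Interchangeable t D' x y →
        Interchangeable t D x y := by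
  have : ∀ x y, ∃ F : Finset E, (F : Set E) ⊆ D ∧ ∀ D' : Set E, ↑F ⊆ D' →
      Interchangeable t D' x y → Interchangeable t D x y := by
    intro x y
    -- A finite set showing that `x` and `y` are not interchangeable still shows it in every `D'`
    -- that contains it.
    by_cases h : Interchangeable t D x y
    · exact ⟨∅, by simp, fun _ _ _ => h⟩
    · have h' := h
      simp only [Interchangeable] at h'
      push Not at h'
      obtain ⟨F, hF, hx, hy, hne⟩ := h'
      exact ⟨F, hF, fun D' hD' h'' => absurd (h'' F hD' hx hy) hne⟩
  choose F hFD hF using this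
  refine ⟨U ∪ U.biUnion fun x => U.biUnion fun y => F x y, Finset.subset_union_left, ?_, ?_⟩
  · intro z hz
    rcases Finset.mem_union.1 (Finset.mem_coe.1 hz) with hz | hz
    · exact hU hz
    · obtain ⟨x, -, hz⟩ := Finset.mem_biUnion.1 hz
      obtain ⟨y, -, hz⟩ := Finset.mem_biUnion.1 hz
      exact hFD x y hz
  · intro x hx y hy D' hD' h
    refine hF x y D' (fun z hz => hD' ?_) h
    exact Finset.mem_union_right _ (Finset.mem_biUnion.2 ⟨x, hx, Finset.mem_biUnion.2 ⟨y, hy, hz⟩⟩)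

include hπ in
/-- If the fibers of the directions are pairwise not interchangeable, the base can be enlarged to
that of a good cell. -/
theorem exists_isGoodCell {U : Finset E} {M : Finset X}
    (hM : ∀ c ∈ M, (π ⁻¹' {c}).Infinite)
    (hsep : ∀ x y, π x ∈ M → π y ∈ M → Interchangeable t (cellDomain π U M) x y → π x = π y) :
    ∃ V N, U ⊆ V ∧ (∀ x ∈ V \ U, π x ∈ M) ∧ IsGoodCell t π V M N := by
  set D := cellDomain π U M with hD
  have huniv : ∀ z w, π z = π w → Interchangeable t D z w := fun z w h =>
    ((hπ z w).1 h).mono (Set.subset_univ _)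
  have hDU : (U : Set E) ⊆ D := Set.subset_union_left
  have hDM : ∀ z, π z ∈ M → z ∈ D := fun z hz => Or.inr hz
  have hMne : ∀ c, c ∈ M → ∃ r, π r = c := fun c hc => (hM c hc).nonempty
  choose r hr using hMne
  -- With a representative of each direction in `U₁`, every element of `D` shares its fiber with an
  -- element of `U₁`, so finitely many pairs decide interchangeability in `D`.
  set U₁ := U ∪ M.attach.image (fun c => r c.1 c.2) with hU₁
  have hrU₁ : ∀ c hc, r c hc ∈ U₁ := fun c hc =>
    Finset.mem_union_right _ (Finset.mem_image.2 ⟨⟨c, hc⟩, Finset.mem_attach _ _, rfl⟩)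
  have hU₁D : (U₁ : Set E) ⊆ D := by
    intro z hz
    rcases Finset.mem_union.1 (Finset.mem_coe.1 hz) with hz | hz
    · exact hDU hz
    · obtain ⟨c, -, rfl⟩ := Finset.mem_image.1 hz
      exact hDM _ (by rw [hr]; exact c.2)
  obtain ⟨V₀, hU₁V₀, hV₀D, hV₀⟩ := exists_finset_interchangeable (t := t) hU₁D
  have hUV₀ : U ⊆ V₀ := Finset.subset_union_left.trans hU₁V₀
  -- A class that meets no added element lies in `V₀` and has fewer than `N` elements. Each
  -- direction class has fewer than `N` elements in `V₀`, so the subtraction in `e` is exact and `e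
  -- c` new elements bring it to `N`.
  set N := V₀.card + 1 with hN
  set e : X → ℕ := fun c =>
    if hc : c ∈ M then N - (V₀.filter (Interchangeable t D (r c hc))).card else 0 with he
  have heM : ∀ c ∉ M, e c = 0 := fun c hc => by simp [he, hc]
  obtain ⟨T, hVT, hT⟩ := exists_disjoint_vec_eq (π := π) V₀ e
    (fun c hc => hM c (by_contra fun h => hc (heM c h)))
  have hTM : ∀ z ∈ T, π z ∈ M := mem_of_vec_eq_zero (fun c hc => by rw [hT, heM c hc])
  have hVD : ((V₀ ∪ T : Finset E) : Set E) ⊆ D := by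
    intro z hz
    rcases Finset.mem_union.1 (Finset.mem_coe.1 hz) with hz | hz
    exacts [hV₀D hz, hDM z (hTM z hz)]
  have hUV : U ⊆ V₀ ∪ T := hUV₀.trans Finset.subset_union_left
  -- All elements added to the base lie in direction fibers, so the domain does not change.
  have hDV : cellDomain π (V₀ ∪ T) M = D :=
    (Set.union_subset hVD Set.subset_union_right).antisymm
      (Set.union_subset_union_left _ (Finset.coe_subset.2 hUV))
  have hrep : ∀ x ∈ V₀ ∪ T, ∃ x' ∈ U₁, π x' = π x := by
    intro x hx
    rcases hVD hx with hxU | hxM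
    · exact ⟨x, Finset.mem_union_left _ hxU, rfl⟩
    · exact ⟨r (π x) hxM, hrU₁ _ _, hr _ _⟩
  refine ⟨V₀ ∪ T, N, hUV, ?_, ?_⟩
  · intro x hx
    obtain ⟨hxV, hxU⟩ := Finset.mem_sdiff.1 hx
    exact (hVD hxV).resolve_left hxU
  · refine ⟨hM, ?_, ?_, ?_, ?_, ?_⟩
    · exact fun c hc => ⟨r c hc, Finset.mem_union_left _ (hU₁V₀ (hrU₁ c hc)), hr c hc⟩
    · rwa [hDV]
    · rw [hDV]
      intro x hx y hy hxy
      obtain ⟨x', hx', hxx'⟩ := hrep x hx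
      obtain ⟨y', hy', hyy'⟩ := hrep y hy
      have hx'V : x' ∈ V₀ ∪ T := Finset.mem_union_left _ (hU₁V₀ hx')
      have hy'V : y' ∈ V₀ ∪ T := Finset.mem_union_left _ (hU₁V₀ hy')
      have h₁ : Interchangeable t ((V₀ ∪ T : Finset E) : Set E) x' y' :=
        (((hπ _ _).1 hxx').mono (Set.subset_univ _) |>.trans hx'V hy hxy).trans hx'V hy'V
          (((hπ _ _).1 hyy'.symm).mono (Set.subset_univ _))
      have h₂ := hV₀ x' hx' y' hy' _ (Finset.coe_subset.2 Finset.subset_union_left) h₁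
      exact ((huniv _ _ hxx'.symm).trans (hVD hx) (hVD hy'V) h₂).trans (hVD hx) (hVD hy)
        (huniv _ _ hyy')
    · rw [hDV]
      intro x hx hxM
      have hrx : Interchangeable t D (r (π x) hxM) x := huniv _ _ (hr _ _)
      have hcongr : ∀ z ∈ D, (Interchangeable t D x z ↔ Interchangeable t D (r (π x) hxM) z) :=
        fun z hz => ⟨fun h => hrx.trans (hDM _ (by rw [hr]; exact hxM)) hz h,
          fun h => hrx.symm.trans (hVD hx) hz h⟩
      rw [Finset.filter_congr fun z hz => hcongr z (hVD hz), Finset.filter_union,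
        Finset.card_union_of_disjoint (Finset.disjoint_filter_filter hVT)]
      have h₁ : T.filter (Interchangeable t D (r (π x) hxM))
          = T.filter (fun z => π z = π x) := by
        refine Finset.filter_congr fun z hz => ⟨fun h => ?_, fun h => huniv _ _ ?_⟩
        · rw [← hsep _ _ (by rw [hr]; exact hxM) (hTM z hz) h, hr]
        · rw [hr, h]
      have h₂ : (T.filter (fun z => π z = π x)).card = e (π x) := congrFun hT (π x)
      have h₃ := Finset.card_filter_le V₀ (Interchangeable t D (r (π x) hxM))
      rw [h₁, h₂]
      simp only [he, dif_pos hxM]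
      omega
    · rw [hDV]
      intro x hx hle
      by_contra! hcon
      have : (V₀ ∪ T).filter (Interchangeable t D x) ⊆ V₀ := by
        intro z hz
        obtain ⟨hz, hxz⟩ := Finset.mem_filter.1 hz
        rcases Finset.mem_union.1 hz with hz | hz
        exacts [hz, absurd hxz (hcon z (hTM z hz))]
      have := Finset.card_le_card this
      omega

include hπ in
/-- The types of a cell are covered by finitely many good cells. -/
theorem exists_isGoodCell_cover (U : Finset E) (M : Finset X)
    (hM : ∀ c ∈ M, (π ⁻¹' {c}).Infinite) :
    ∃ Q : Finset (Finset E × Finset X × ℕ), (∀ q ∈ Q, IsGoodCell t π q.1 q.2.1 q.2.2) ∧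
      ∀ τ ∈ cellTypes t π U M, ∃ q ∈ Q, τ ∈ cellTypes t π q.1 q.2.1 := by
  induction hn : M.card generalizing U M with
  | zero =>
    obtain ⟨V, N, hUV, hVM, hgood⟩ := exists_isGoodCell hπ (t := t) (U := U) (M := M) hM
      (by simp [Finset.card_eq_zero.1 hn])
    have hV : V = U := by
      refine (Finset.sdiff_eq_empty_iff_subset.1 ?_).antisymm hUV
      refine Finset.eq_empty_of_forall_notMem fun x hx => ?_
      simpa [Finset.card_eq_zero.1 hn] using hVM x hx
    exact ⟨{(V, M, N)}, by simpa using hgood, fun τ hτ => ⟨_, Finset.mem_singleton_self _,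
      by simpa [hV] using hτ⟩⟩
  | succ n ih =>
    have hMe : ∀ c, ∀ c' ∈ M.erase c, (π ⁻¹' {c'}).Infinite :=
      fun c c' hc' => hM c' (Finset.mem_of_mem_erase hc')
    have hcard : ∀ c ∈ M, (M.erase c).card = n := fun c hc => by
      rw [Finset.card_erase_of_mem hc]; omega
    by_cases hsep : ∀ x y, π x ∈ M → π y ∈ M → Interchangeable t (cellDomain π U M) x y →
        π x = π y
    · obtain ⟨V, N, hUV, hVM, hgood⟩ := exists_isGoodCell hπ (t := t) (U := U) (M := M) hM hsep
      -- Vectors `a ≥ v` fall into the good cell of base `V`. Any other has `a c < v c` for some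
      -- direction `c`; freezing this entry leaves finitely many cells with one direction fewer.
      set v := vec π (V \ U) with hv
      have hvM : ∀ c ∉ M, v c = 0 := fun c hc => vec_eq_zero_of_notMem hVM hc
      have hvV : vec π V = vec π U + v := by rw [hv, add_comm, vec_sdiff_add hUV]
      have hW : ∀ c : M, ∀ i : ℕ, ∃ W : Finset E, vec π W = vec π U + Pi.single c.1 i := by
        intro c i
        obtain ⟨W, -, hW⟩ := exists_superset_vec_eq (π := π) U (Pi.single c.1 i) (by
          intro c' hc'
          by_cases h : c' = c.1
          · rw [h]; exact hM _ c.2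
          · simp [h] at hc')
        exact ⟨W, hW⟩
      choose W hW using hW
      choose Q hQgood hQ using fun (c : M) (i : ℕ) =>
        ih (W c i) (M.erase c.1) (hMe c.1) (hcard c.1 c.2)
      refine ⟨insert (V, M, N)
        (M.attach.biUnion fun c => (Finset.range (v c.1)).biUnion fun i => Q c i), ?_, ?_⟩
      · intro q hq
        rcases Finset.mem_insert.1 hq with rfl | hq
        · exact hgood
        · obtain ⟨c, -, hq⟩ := Finset.mem_biUnion.1 hq
          obtain ⟨i, -, hq⟩ := Finset.mem_biUnion.1 hq
          exact hQgood c i q hq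
      · rintro τ ⟨A, a, ha, hA, rfl⟩
        by_cases hva : v ≤ a
        · refine ⟨_, Finset.mem_insert_self _ _, A, a - v, ?_, ?_, rfl⟩
          · intro c hc
            simp [ha c hc]
          · rw [hA, hvV, add_assoc, add_tsub_cancel_of_le hva]
        · obtain ⟨c, hc⟩ : ∃ c, a c < v c := by
            simpa [Pi.le_def] using hva
          have hcM : c ∈ M := by
            by_contra h
            simp [hvM c h] at hc
          obtain ⟨q, hq, hτ⟩ := hQ ⟨c, hcM⟩ (a c) (t A) ⟨A, Function.update a c 0, by
            intro c' hc'
            by_cases h : c' = c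
            · simp [h]
            · rw [Function.update_of_ne h]
              exact ha c' fun h' => hc' (Finset.mem_erase.2 ⟨h, h'⟩), by
            rw [hA, hW, add_assoc]
            congr 1
            ext c'
            by_cases h : c' = c
            · subst h; simp
            · simp [h], rfl⟩
          exact ⟨q, Finset.mem_insert_of_mem (Finset.mem_biUnion.2 ⟨⟨c, hcM⟩,
            Finset.mem_attach _ _, Finset.mem_biUnion.2 ⟨a c, Finset.mem_range.2 hc, hq⟩⟩), hτ⟩
    · push Not at hsep
      obtain ⟨x, y, hx, hy, hxy, hne⟩ := hsep
      obtain ⟨Q, hQgood, hQ⟩ := ih U (M.erase (π y)) (hMe _) (hcard _ hy)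
      exact ⟨Q, hQgood, fun τ hτ => hQ τ (cellTypes_subset_erase hπ hM hx hne hxy hτ)⟩

end Cells

/-! ### Isomorphisms between good cells, and least codes -/

section Leading

open Classical

variable {E α X : Type*} [Fintype X] {t : Finset E → α} {π : E → X}

theorem exists_superset_of_vec_eq (hπ : ∀ x y, π x = π y ↔ Interchangeable t Set.univ x y)
    {U A : Finset E} {M : Finset X} {a : X → ℕ} (hM : ∀ c ∈ M, (π ⁻¹' {c}).Infinite)
    (ha : ∀ c ∉ M, a c = 0) (hA : vec π A = vec π U + a) :
    ∃ B, U ⊆ B ∧ vec π B = vec π U + a ∧ t B = t A := by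
  obtain ⟨B, hUB, hB⟩ := exists_superset_vec_eq (π := π) U a
    (fun c hc => hM c (by_contra fun h => hc (ha c h)))
  exact ⟨B, hUB, hB, eq_of_vec_eq hπ (hB.trans hA.symm)⟩

omit [Fintype X] in
theorem vec_sdiff_eq {U A : Finset E} {a : X → ℕ} (hUA : U ⊆ A) (hA : vec π A = vec π U + a) :
    vec π (A \ U) = a := by
  have := vec_sdiff_add (π := π) hUA
  rw [hA, add_comm] at this
  exact add_left_cancel this

omit [Fintype X] in
theorem subset_cellDomain {U A : Finset E} {M : Finset X} {a : X → ℕ} (ha : ∀ c ∉ M, a c = 0)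
    (hUA : U ⊆ A) (hA : vec π A = vec π U + a) : (A : Set E) ⊆ cellDomain π U M := by
  intro x hx
  by_cases hxU : x ∈ U
  · exact Or.inl hxU
  · refine Or.inr (mem_of_vec_eq_zero (T := A \ U) ?_ x (Finset.mem_sdiff.2 ⟨hx, hxU⟩))
    rwa [vec_sdiff_eq hUA hA]

namespace IsGoodCell

variable {U A : Finset E} {M : Finset X} {N : ℕ} {a : X → ℕ}

omit [Fintype X] in
-- By `meets`, each element of `A` shares its fiber with an element of the base. This reduces the
-- question to two elements of `U`, which `fat` settles.
theorem interchangeable_iff (hU : IsGoodCell t π U M N)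
    (hπ : ∀ x y, π x = π y ↔ Interchangeable t Set.univ x y) (hUA : U ⊆ A)
    (hA : (A : Set E) ⊆ cellDomain π U M) {x y : E} (hx : x ∈ A) (hy : y ∈ A) :
    Interchangeable t (A : Set E) x y ↔ Interchangeable t (cellDomain π U M) x y := by
  refine ⟨fun h => ?_, fun h => h.mono hA⟩
  have hrep : ∀ z ∈ A, ∃ z' ∈ U, π z' = π z := by
    intro z hz
    rcases hA hz with hzU | hzM
    exacts [⟨z, hzU, rfl⟩, hU.meets _ hzM]
  obtain ⟨x', hx', hxx'⟩ := hrep x hx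
  obtain ⟨y', hy', hyy'⟩ := hrep y hy
  have huniv : ∀ {z w} {D : Set E}, π z = π w → Interchangeable t D z w := fun h =>
    ((hπ _ _).1 h).mono (Set.subset_univ _)
  have h₁ : Interchangeable t (A : Set E) x' y' :=
    ((huniv hxx').trans (hUA hx') hy h).trans (hUA hx') (hUA hy') (huniv hyy'.symm)
  have h₂ := hU.fat x' hx' y' hy' (h₁.mono (Finset.coe_subset.2 hUA))
  exact ((huniv hxx'.symm).trans (hA hx) (hA (hUA hy')) h₂).trans (hA hx) (hA hy) (huniv hyy')

omit [Fintype X] in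
-- The class consists of `N` base elements, by `card_eq`, and of the additional elements in the
-- fiber of `z`; `separated` excludes additional elements of other fibers.
theorem card_class (hU : IsGoodCell t π U M N)
    (hπ : ∀ x y, π x = π y ↔ Interchangeable t Set.univ x y) (ha : ∀ c ∉ M, a c = 0)
    (hUA : U ⊆ A) (hA : vec π A = vec π U + a) {z : E} (hz : z ∈ A) (hzM : π z ∈ M) :
    (A.filter (Interchangeable t (A : Set E) z)).card = N + a (π z) := by
  have hAD := subset_cellDomain ha hUA hA
  obtain ⟨x, hxU, hxz⟩ := hU.meets _ hzM
  have hxz' : Interchangeable t (cellDomain π U M) x z :=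
    ((hπ _ _).1 hxz).mono (Set.subset_univ _)
  have h₁ : A.filter (Interchangeable t (A : Set E) z)
      = U.filter (Interchangeable t (cellDomain π U M) x) ∪
        (A \ U).filter (fun w => π w = π z) := by
    rw [Finset.filter_congr fun w hw => hU.interchangeable_iff hπ hUA hAD hz hw]
    conv_lhs => rw [← Finset.union_sdiff_of_subset hUA]
    rw [Finset.filter_union]
    congr 1
    · refine Finset.filter_congr fun w hw => ⟨fun h => ?_, fun h => ?_⟩
      · exact hxz'.trans (hAD (hUA hxU)) (hAD (hUA hw)) h
      · exact hxz'.symm.trans (hAD hz) (hAD (hUA hw)) h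
    · refine Finset.filter_congr fun w hw => ⟨fun h => ?_, fun h => ?_⟩
      · refine (hU.separated _ _ hzM ?_ h).symm
        refine mem_of_vec_eq_zero (T := A \ U) ?_ w hw
        rwa [vec_sdiff_eq hUA hA]
      · exact ((hπ _ _).1 h.symm).mono (Set.subset_univ _)
  rw [h₁, Finset.card_union_of_disjoint
    (Finset.disjoint_filter_filter Finset.disjoint_sdiff),
    hU.card_eq x hxU (by rwa [hxz])]
  congr 1
  exact congrFun (vec_sdiff_eq hUA hA) (π z)

omit [Fintype X] in
-- With `card_class`, this makes size at least `N` the mark of direction classes. A class that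
-- avoids the direction fibers lies in the base, where `exists_of_le` applies.
theorem exists_of_le_card_class (hU : IsGoodCell t π U M N)
    (hπ : ∀ x y, π x = π y ↔ Interchangeable t Set.univ x y) (ha : ∀ c ∉ M, a c = 0)
    (hUA : U ⊆ A) (hA : vec π A = vec π U + a) {z : E} (hz : z ∈ A)
    (hcard : N ≤ (A.filter (Interchangeable t (A : Set E) z)).card) :
    ∃ y ∈ U, π y ∈ M ∧ Interchangeable t (cellDomain π U M) z y := by
  have hAD := subset_cellDomain ha hUA hA
  rw [Finset.filter_congr fun w hw => hU.interchangeable_iff hπ hUA hAD hz hw] at hcard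
  suffices h : ∃ y, π y ∈ M ∧ Interchangeable t (cellDomain π U M) z y by
    obtain ⟨y, hyM, hzy⟩ := h
    obtain ⟨y', hy'U, hy'⟩ := hU.meets _ hyM
    exact ⟨y', hy'U, by rwa [hy'], hzy.trans (hAD hz) (hAD (hUA hy'U))
      (((hπ _ _).1 hy'.symm).mono (Set.subset_univ _))⟩
  by_contra! hcon
  have hzU : z ∈ U := by
    refine (hAD hz).resolve_right fun h => hcon z h (Interchangeable.refl _ _ _)
  obtain ⟨y, hyM, hy⟩ := hU.exists_of_le z hzU (hcard.trans (Finset.card_le_card (by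
    intro w hw
    obtain ⟨hwA, hzw⟩ := Finset.mem_filter.1 hw
    exact Finset.mem_filter.2 ⟨(hAD hwA).resolve_right fun h => hcon w h hzw, hzw⟩)))
  exact hcon y hyM hy

end IsGoodCell

omit [Fintype X] in
/-- A type preserving map from a set of a good cell to a set of a good cell of lower level maps
the directions of the first one to directions of the second one. -/
theorem exists_direction_map {U U' B : Finset E} {M M' : Finset X} {N N' : ℕ} {b b' : X → ℕ}
    (hπ : ∀ x y, π x = π y ↔ Interchangeable t Set.univ x y)
    (hU : IsGoodCell t π U M N) (hU' : IsGoodCell t π U' M' N') (hN : N' ≤ N)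
    (hb : ∀ c ∉ M, b c = 0) (hb' : ∀ c ∉ M', b' c = 0)
    (hUB : U ⊆ B) (hB : vec π B = vec π U + b) {f : E → E} (hf : Set.InjOn f B)
    (hft : ∀ F ⊆ B, t F = t (F.image f)) (hUB' : U' ⊆ B.image f)
    (hB' : vec π (B.image f) = vec π U' + b') :
    ∃ y : E → E, (∀ z ∈ B, π z ∈ M → y z ∈ U' ∧ π (y z) ∈ M' ∧
      Interchangeable t (B.image f : Set E) (f z) (y z) ∧
      N' + b' (π (y z)) = N + b (π z)) ∧
      ∀ z ∈ B, ∀ z' ∈ B, π z ∈ M → π z' ∈ M → (π (y z) = π (y z') ↔ π z = π z') := by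
  have hBD := subset_cellDomain hb hUB hB
  have hBD' := subset_cellDomain hb' hUB' hB'
  -- The class of `f z` has `N + b (π z) ≥ N'` elements, so it is a direction class of the second
  -- cell. But `f z` itself may be a base element outside the direction fibers, so it is represented
  -- by an interchangeable `y z` of `U'` inside one.
  have key : ∀ z, ∃ y, z ∈ B → π z ∈ M → y ∈ U' ∧ π y ∈ M' ∧
      Interchangeable t (B.image f : Set E) (f z) y ∧ N' + b' (π y) = N + b (π z) := by
    intro z
    by_cases hz : z ∈ B ∧ π z ∈ M
    · obtain ⟨hzB, hzM⟩ := hz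
      have h₁ := hU.card_class hπ hb hUB hB hzB hzM
      rw [← card_filter_interchangeable_image hf hft hzB] at h₁
      have hfz : f z ∈ B.image f := Finset.mem_image_of_mem f hzB
      obtain ⟨y, hyU', hyM', hy⟩ := hU'.exists_of_le_card_class hπ hb' hUB' hB'
        hfz (by omega)
      have hy' := (hU'.interchangeable_iff hπ hUB' hBD' hfz (hUB' hyU')).2 hy
      refine ⟨y, fun _ _ => ⟨hyU', hyM', by simpa using hy', ?_⟩⟩
      rw [← h₁, ← hU'.card_class hπ hb' hUB' hB' (hUB' hyU') hyM']
      congr 1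
      refine Finset.filter_congr fun w hw => ⟨fun h => ?_, fun h => ?_⟩
      · exact hy'.trans hfz hw h
      · exact hy'.symm.trans (hUB' hyU') hw h
    · exact ⟨z, fun h₁ h₂ => absurd ⟨h₁, h₂⟩ hz⟩
  choose y hy using key
  refine ⟨y, hy, fun z hz z' hz' hzM hz'M => ?_⟩
  obtain ⟨h₁, h₂, h₃, -⟩ := hy z hz hzM
  obtain ⟨h₁', h₂', h₃', -⟩ := hy z' hz' hz'M
  have hfz : f z ∈ (B.image f : Set E) := Finset.mem_image_of_mem f hz
  have hfz' : f z' ∈ (B.image f : Set E) := Finset.mem_image_of_mem f hz'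
  have hyz : y z ∈ (B.image f : Set E) := by simpa using hUB' h₁
  have hyz' : y z' ∈ (B.image f : Set E) := by simpa using hUB' h₁'
  constructor
  · intro h
    have h₄ : Interchangeable t (B.image f : Set E) (y z) (y z') :=
      ((hπ _ _).1 h).mono (Set.subset_univ _)
    have h₅ : Interchangeable t (B.image f : Set E) (f z) (f z') :=
      (h₃.trans hfz hyz' h₄).trans hfz hfz' h₃'.symm
    have h₆ := (interchangeable_image_iff hf hft hz hz').1 h₅
    exact hU.separated _ _ hzM hz'M ((hU.interchangeable_iff hπ hUB hBD hz hz').1 h₆)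
  · intro h
    have h₆ : Interchangeable t (B : Set E) z z' := ((hπ _ _).1 h).mono (Set.subset_univ _)
    have h₅ := (interchangeable_image_iff hf hft hz hz').2 h₆
    have h₄ : Interchangeable t (B.image f : Set E) (y z) (y z') :=
      (h₃.symm.trans hyz hfz' h₅).trans hyz hyz' h₃'
    refine hU'.separated _ _ h₂ h₂' ((hU'.interchangeable_iff hπ hUB' hBD' ?_ ?_).1 (by
      simpa using h₄))
    exacts [hUB' h₁, hUB' h₁']

/-- Adding one to the entries that are at least `h`. -/
def bump (h : ℕ) (a : X → ℕ) (c : X) : ℕ := if h ≤ a c then a c + 1 else a c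

omit [Fintype X] in
-- On each entry a bump is a strictly increasing function of the value, so the first difference
-- keeps its place and its sign.
theorem toLex_bump_le [LinearOrder X] [WellFoundedLT X] {h : ℕ} {a b : X → ℕ}
    (hab : toLex a ≤ toLex b) : toLex (bump h a) ≤ toLex (bump h b) := by
  rcases hab.eq_or_lt with hab | hab
  · rw [toLex_inj.1 hab]
  · obtain ⟨c, hc, hlt⟩ := hab
    refine le_of_lt ⟨c, fun c' hc' => ?_, ?_⟩
    · have := hc c' hc'
      simp only [Pi.toLex_apply] at this
      simp [bump, this]
    · simp only [Pi.toLex_apply, bump] at hlt ⊢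
      split_ifs <;> omega

section Codes

variable {n : ℕ} {U : Fin n → Finset E} {M : Fin n → Finset X} {N : Fin n → ℕ}

/-- The pair `(i, a)` codes the type of the sets having `a c` more elements than `U i` in the fiber
of `c`. It is leading if it is the least code of that type
(first for the order of the indices, then for `r`). -/
def IsLeading (r : (X → ℕ) → (X → ℕ) → Prop) (t : Finset E → α) (π : E → X) (U : Fin n → Finset E)
    (M : Fin n → Finset X) (i : Fin n) (a : X → ℕ) : Prop :=
  (∀ c ∉ M i, a c = 0) ∧ ∀ A, vec π A = vec π (U i) + a → ∀ j b, (∀ c ∉ M j, b c = 0) →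
    ∀ B, vec π B = vec π (U j) + b → t B = t A → i < j ∨ i = j ∧ r a b

/-- Suppose that `(j, b')` violates the minimality of `(i, bump h a)`. Removing the added layer from
a set with the bumped code, and the matching elements on the other side of an isomorphism, yields a
code `(j, b'')` of the type of `a`. Minimality of `(i, a)` forces `i = j` and `r a b''`. The
isomorphism then permutes the directions, so `b' = bump h b''`, and monotonicity of `r` gives a
contradiction. The condition `1 ≤ h` keeps the entries outside `M i` equal to 0. -/
theorem IsLeading.bump {r : (X → ℕ) → (X → ℕ) → Prop}
    (hr : ∀ h a b, r a b → r (bump h a) (bump h b))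
    (hπ : ∀ x y, π x = π y ↔ Interchangeable t Set.univ x y) (ht : IsHereditary t)
    (hU : ∀ i, IsGoodCell t π (U i) (M i) (N i)) (hN : Monotone N) {i : Fin n} {a : X → ℕ}
    (ha : IsLeading r t π U M i a) {h : ℕ} (hh : 1 ≤ h) : IsLeading r t π U M i (bump h a) := by
  have hbM : ∀ c ∉ M i, RelationalStructure.bump h a c = 0 := by
    intro c hc
    have := ha.1 c hc
    simp only [RelationalStructure.bump, this]
    rw [if_neg (by omega)]
  refine ⟨hbM, fun B₀ hB₀ j b' hb' B₀' hB₀' htB₀ => ?_⟩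
  by_contra hcon
  have hji : j ≤ i := by
    by_contra hij
    exact hcon (Or.inl (not_le.1 hij))
  obtain ⟨B, hUB, hB, htB⟩ := exists_superset_of_vec_eq hπ (hU i).infinite hbM hB₀
  obtain ⟨B', hUB', hB', htB'⟩ := exists_superset_of_vec_eq hπ (hU j).infinite hb' hB₀'
  obtain ⟨f, hf, rfl, hft⟩ := ht B B' (by rw [htB, htB', htB₀])
  obtain ⟨y, hy, hyy⟩ := exists_direction_map hπ (hU i) (hU j) (hN hji) hbM hb' hUB hB hf hft
    hUB' hB'
  have haB : vec π (U i) + a ≤ vec π B := by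
    rw [hB]
    refine add_le_add le_rfl fun c => ?_
    simp only [RelationalStructure.bump]
    split_ifs <;> omega
  obtain ⟨A, hAB, hA⟩ := exists_subset_vec_eq haB
  -- `T` is the added layer: one element in each fiber `c` with `h ≤ a c`.
  set T := B \ A with hT
  have hvT : ∀ c, vec π T c = if h ≤ a c then 1 else 0 := by
    intro c
    have hadd : vec π T + vec π A = vec π B := vec_sdiff_add hAB
    have := congrFun hadd c
    simp only [Pi.add_apply, hA, hB, RelationalStructure.bump] at this
    split_ifs at this ⊢ <;> omega
  have hTB : T ⊆ B := Finset.sdiff_subset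
  have hTh : ∀ z ∈ T, h ≤ a (π z) := by
    intro z hz
    have := vec_pos (π := π) hz
    rw [hvT] at this
    by_contra hc
    simp [hc] at this
  have hTM : ∀ z ∈ T, π z ∈ M i := by
    intro z hz
    by_contra hc
    have := hTh z hz
    rw [ha.1 _ hc] at this
    omega
  have hTinj : ∀ z ∈ T, ∀ z' ∈ T, π z = π z' → z = z' := by
    intro z hz z' hz' hzz'
    have hle : vec π T (π z) ≤ 1 := by rw [hvT]; split_ifs <;> omega
    exact Finset.card_le_one.1 hle z (by simp [hz]) z' (by simp [hz', hzz'])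
  have hyinj : Set.InjOn y T := fun z hz z' hz' hzz' => hTinj z hz z' hz'
    ((hyy z (hTB hz) z' (hTB hz') (hTM z hz) (hTM z' hz')).1 (by rw [hzz']))
  -- the vector of the set of all `y z` for `z ∈ T`
  have hvT' : ∀ z ∈ B, π z ∈ M i →
      vec π (T.image y) (π (y z)) = if h ≤ a (π z) then 1 else 0 := by
    intro z hz hzM
    rw [← hvT, vec, vec, Finset.filter_image, Finset.card_image_of_injOn
      (hyinj.mono (Finset.coe_subset.2 (Finset.filter_subset _ _)))]
    congr 1
    exact Finset.filter_congr fun w hw => hyy w (hTB hw) z hz (hTM w hw) hzM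
  have hyB : T.image y ⊆ B.image f := by
    intro w hw
    obtain ⟨z, hz, rfl⟩ := Finset.mem_image.1 hw
    exact hUB' (hy z (hTB hz) (hTM z hz)).1
  have hle : vec π (T.image y) ≤ b' := by
    intro c
    rcases Nat.eq_zero_or_pos (vec π (T.image y) c) with h0 | hpos
    · rw [h0]; exact Nat.zero_le _
    · obtain ⟨w, hw, rfl⟩ := exists_mem_of_vec_pos hpos
      obtain ⟨z, hz, rfl⟩ := Finset.mem_image.1 hw
      obtain ⟨-, -, -, h₄⟩ := hy z (hTB hz) (hTM z hz)
      have hNN := hN hji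
      rw [hvT' z (hTB hz) (hTM z hz), if_pos (hTh z hz)]
      simp only [RelationalStructure.bump, if_pos (hTh z hz)] at h₄
      have : 1 ≤ b' (π (y z)) := by omega
      exact this
  set b'' := b' - vec π (T.image y) with hb''
  have hb''M : ∀ c ∉ M j, b'' c = 0 := fun c hc => by simp [hb'', hb' c hc]
  have hvA' : vec π (B.image f \ T.image y) = vec π (U j) + b'' := by
    have : vec π (B.image f \ T.image y) + vec π (T.image y) = vec π (U j) + b' := by
      rw [vec_sdiff_add hyB, hB']
    ext c
    have h₁ := congrFun this c
    have h₂ : vec π (T.image y) c ≤ b' c := hle c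
    simp only [Pi.add_apply, hb'', Pi.sub_apply] at h₁ ⊢
    omega
  have hfAT : A.image f = B.image f \ T.image f := by
    rw [← Finset.image_sdiff_of_injOn hf hTB, hT, Finset.sdiff_sdiff_eq_self hAB]
  -- Each `y z` is interchangeable with `f z` in `f(B)`, so deleting `y(T)` or `f(T)` takes the same
  -- number of elements from every class.
  have htA : t (B.image f \ T.image y) = t A := by
    rw [hft A hAB, hfAT]
    refine eq_of_card_filter_interchangeable (D := (B.image f : Finset E))
      (Finset.coe_subset.2 Finset.sdiff_subset) (Finset.coe_subset.2 Finset.sdiff_subset)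
      fun w hw => ?_
    have hfT : T.image f ⊆ B.image f := Finset.image_subset_image hTB
    have hsd : ∀ (R S : Finset E) (p : E → Prop), S ⊆ R →
        ((R \ S).filter p).card = (R.filter p).card - (S.filter p).card := by
      intro R S p hSR
      rw [← Finset.card_sdiff_of_subset (Finset.filter_subset_filter p hSR)]
      congr 1
      ext v
      simp only [Finset.mem_filter, Finset.mem_sdiff]
      tauto
    rw [hsd _ _ _ hyB, hsd _ _ _ hfT]
    congr 1
    rw [Finset.filter_image, Finset.filter_image, Finset.card_image_of_injOn
      (hyinj.mono (Finset.coe_subset.2 (Finset.filter_subset _ _))), Finset.card_image_of_injOn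
      ((hf.mono (Finset.coe_subset.2 hTB)).mono (Finset.coe_subset.2 (Finset.filter_subset _ _)))]
    congr 1
    refine Finset.filter_congr fun z hz => ?_
    obtain ⟨h₁, -, h₃, -⟩ := hy z (hTB hz) (hTM z hz)
    exact (h₃.congr_left (Finset.mem_image_of_mem f (hTB hz)) (hUB' h₁) hw).symm
  rcases ha.2 A hA j b'' hb''M _ hvA' htA with hlt | ⟨rfl, hle'⟩
  · exact absurd hlt (not_lt.2 hji)
  · refine hcon (Or.inr ⟨rfl, ?_⟩)
    have hsec : ∀ c : M i, ∃ z ∈ B, π z = c := fun c => by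
      obtain ⟨z, hz, hzc⟩ := (hU i).meets c c.2
      exact ⟨z, hUB hz, hzc⟩
    choose z hzB hz using hsec
    have hzM : ∀ c : M i, π (z c) ∈ M i := fun c => by rw [hz]; exact c.2
    -- In a single cell the levels cancel: `b' (σ d) = bump h a d` and `b'' (σ d) = a d`. As an
    -- injective self-map of a finite set, `σ` reaches every direction.
    let σ : M i → M i := fun c => ⟨π (y (z c)), (hy _ (hzB c) (hzM c)).2.1⟩
    have hσ : Function.Injective σ := by
      intro c c' hcc'
      have := (hyy _ (hzB c) _ (hzB c') (hzM c) (hzM c')).1 (congrArg Subtype.val hcc')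
      rw [hz, hz] at this
      exact Subtype.ext this
    have hbump : b' = RelationalStructure.bump h b'' := by
      ext c
      by_cases hc : c ∈ M i
      · obtain ⟨d, hd⟩ := (Finite.injective_iff_surjective.1 hσ) ⟨c, hc⟩
        have hd' : π (y (z d)) = c := congrArg Subtype.val hd
        have h₁ := (hy _ (hzB d) (hzM d)).2.2.2
        have h₂ := hvT' _ (hzB d) (hzM d)
        rw [hd'] at h₁ h₂
        simp only [RelationalStructure.bump, hb'', Pi.sub_apply, h₂] at h₁ ⊢
        split_ifs at h₁ ⊢ <;> omega
      · simp only [RelationalStructure.bump, hb''M c hc, hb' c hc]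
        rw [if_neg (by omega)]
    rw [hbump]
    exact hr _ _ _ hle'

omit [Fintype X] in
theorem exists_monotone_enumeration (Q : Finset (Finset E × Finset X × ℕ)) :
    ∃ (n : ℕ) (e : Fin n → Finset E × Finset X × ℕ),
      (∀ q, q ∈ Q ↔ ∃ i, e i = q) ∧ Monotone fun i => (e i).2.2 := by
  let e₀ : Fin Q.card → Q := Q.equivFin.symm
  let g : Fin Q.card → ℕ := fun i => (e₀ i).1.2.2
  refine ⟨Q.card, fun i => (e₀ (Tuple.sort g i)).1, fun q => ⟨fun hq => ?_, ?_⟩,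
    Tuple.monotone_sort g⟩
  · refine ⟨(Tuple.sort g).symm (Q.equivFin ⟨q, hq⟩), ?_⟩
    simp [e₀]
  · rintro ⟨i, rfl⟩
    exact (e₀ _).2

/-- The types are coded in a unique way by finitely many families of vectors, each of which is
stable by adding layers. -/
theorem exists_bump_closed_codes
    (hπ : ∀ x y, π x = π y ↔ Interchangeable t Set.univ x y) (ht : IsHereditary t) :
    ∃ (n : ℕ) (u : Fin n → X → ℕ) (Λ : Fin n → Set (X → ℕ)),
      (∀ i, ∀ a ∈ Λ i, ∀ h, 1 ≤ h → bump h a ∈ Λ i) ∧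
      (∀ i, ∀ a ∈ Λ i, ∃ A, vec π A = u i + a) ∧
      ∀ A, ∃! p : Fin n × (X → ℕ), p.2 ∈ Λ p.1 ∧ ∃ B, vec π B = u p.1 + p.2 ∧ t B = t A := by
  -- a finite cover by good cells
  let M₀ : Finset X := Finset.univ.filter fun c => (π ⁻¹' {c}).Infinite
  have hM₀ : ∀ c ∈ M₀, (π ⁻¹' {c}).Infinite := fun c hc => (Finset.mem_filter.1 hc).2
  -- The finite fibers have a finite union. Each subset of it serves as a base, with all infinite
  -- fibers as directions, and these cells contain all finite sets.
  have hfin : (⋃ c ∈ {c : X | ¬ (π ⁻¹' {c}).Infinite}, π ⁻¹' {c}).Finite :=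
    Set.Finite.biUnion (Set.toFinite _) fun c hc => Set.not_infinite.1 hc
  choose Q hQgood hQ using fun U => exists_isGoodCell_cover hπ U M₀ hM₀
  obtain ⟨n, e, he, hmono⟩ := exists_monotone_enumeration (hfin.toFinset.powerset.biUnion Q)
  have hgood : ∀ i, IsGoodCell t π (e i).1 (e i).2.1 (e i).2.2 := by
    intro i
    obtain ⟨U, -, hU⟩ := Finset.mem_biUnion.1 ((he (e i)).2 ⟨i, rfl⟩)
    exact hQgood U _ hU
  have hcover : ∀ A, ∃ i b, (∀ c ∉ (e i).2.1, b c = 0) ∧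
      ∃ B, vec π B = vec π (e i).1 + b ∧ t B = t A := by
    intro A
    set U := A.filter (fun x => ¬ (π ⁻¹' {π x}).Infinite) with hU
    have hUA : U ⊆ A := Finset.filter_subset _ _
    obtain ⟨q, hq, B, b, hb, hB, hBA⟩ := hQ U (t A) ⟨A, vec π (A \ U), fun c hc => by
      refine vec_eq_zero_of_notMem ?_ hc
      intro x hx
      obtain ⟨hxA, hxU⟩ := Finset.mem_sdiff.1 hx
      refine Finset.mem_filter.2 ⟨Finset.mem_univ _, ?_⟩
      by_contra h
      exact hxU (Finset.mem_filter.2 ⟨hxA, h⟩), by rw [add_comm, vec_sdiff_add hUA], rfl⟩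
    obtain ⟨i, rfl⟩ := (he q).1 (Finset.mem_biUnion.2 ⟨U, by
      rw [Finset.mem_powerset]
      intro x hx
      simp only [Set.Finite.mem_toFinset, Set.mem_iUnion]
      exact ⟨π x, (Finset.mem_filter.1 hx).2, rfl⟩, hq⟩)
    exact ⟨i, b, hb, B, hB, hBA⟩
  -- the leading codes
  obtain ⟨r, hr, hrwf, hrtot⟩ : ∃ r : (X → ℕ) → (X → ℕ) → Prop,
      (∀ h a b, r a b → r (bump h a) (bump h b)) ∧
      (∀ S : Set (X → ℕ), S.Nonempty → ∃ a ∈ S, ∀ b ∈ S, r a b) ∧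
      ∀ a b, r a b → r b a → a = b := by
    let _ : LinearOrder X := LinearOrder.lift' (Fintype.equivFin X) (Fintype.equivFin X).injective
    refine ⟨fun a b => toLex a ≤ toLex b, fun h a b => toLex_bump_le, fun S hS => ?_,
      fun a b h₁ h₂ => toLex_inj.1 (le_antisymm h₁ h₂)⟩
    obtain ⟨a, ha, hmin⟩ := WellFounded.has_min
      (wellFounded_lt (α := Lex (X → ℕ))) (toLex '' S) (hS.image _)
    obtain ⟨a, ha, rfl⟩ := ha
    exact ⟨a, ha, fun b hb => not_lt.1 (hmin _ ⟨b, hb, rfl⟩)⟩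
  set U := fun i => (e i).1 with hU
  set M := fun i => (e i).2.1 with hM
  refine ⟨n, fun i => vec π (U i), fun i => {a | IsLeading r t π U M i a}, ?_, ?_, ?_⟩
  · exact fun i a ha h hh => IsLeading.bump hr hπ ht hgood hmono ha hh
  · intro i a ha
    obtain ⟨B, -, hB⟩ := exists_superset_vec_eq (π := π) (U i) a
      (fun c hc => (hgood i).infinite c (by_contra fun h => hc (ha.1 c h)))
    exact ⟨B, hB⟩
  · intro A
    let S : Fin n → Set (X → ℕ) := fun i => {b | (∀ c ∉ M i, b c = 0) ∧
      ∃ B, vec π B = vec π (U i) + b ∧ t B = t A}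
    have hS : ∃ i, (S i).Nonempty := by
      obtain ⟨i, b, hb⟩ := hcover A
      exact ⟨i, b, hb⟩
    obtain ⟨i, hi, hmin⟩ := WellFounded.has_min (wellFounded_lt (α := Fin n))
      {i | (S i).Nonempty} hS
    obtain ⟨a, ⟨haM, B, hB, hBA⟩, hamin⟩ := hrwf (S i) hi
    refine ⟨(i, a), ⟨⟨haM, fun B' hB' j b hb C hC hCB' => ?_⟩, B, hB, hBA⟩, ?_⟩
    · have hbS : b ∈ S j := ⟨hb, C, hC, by
        rw [hCB', ← hBA]
        exact eq_of_vec_eq hπ (hB'.trans hB.symm)⟩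
      rcases (not_lt.1 (hmin j ⟨b, hbS⟩)).lt_or_eq with hlt | rfl
      · exact Or.inl hlt
      · exact Or.inr ⟨rfl, hamin b hbS⟩
    · rintro ⟨j, b⟩ ⟨hb, C, hC, hCA⟩
      have h₁ := hb.2 C hC i a haM B hB (hBA.trans hCA.symm)
      have hbS : b ∈ S j := ⟨hb.1, C, hC, hCA⟩
      rcases h₁ with hlt | ⟨rfl, hba⟩
      · exact absurd hlt (not_lt.2 (not_lt.1 (hmin j ⟨b, hbS⟩)))
      · exact Prod.ext rfl (hrtot _ _ hba (hamin b hbS))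

end Codes

end Leading

/-! ### Layers of vectors and decomposition into pieces -/

section Layers

open Classical

variable {X : Type*}

/-- The indicator vector of a finite set. -/
def ind (S : Finset X) (c : X) : ℕ := if c ∈ S then 1 else 0

theorem ind_of_mem {S : Finset X} {c : X} (h : c ∈ S) : ind S c = 1 := if_pos h

theorem ind_of_notMem {S : Finset X} {c : X} (h : c ∉ S) : ind S c = 0 := if_neg h

/-- The linear combinations of the indicator vectors of the sets of a list. -/
def layerSpan : List (Finset X) → Set (X → ℕ)
  | [] => {0}
  | S :: l => {v | ∃ m : ℕ, ∃ w ∈ layerSpan l, v = m • ind S + w}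

/-- A strictly decreasing list of nonempty sets. -/
def IsLayerChain (l : List (Finset X)) : Prop :=
  l.Pairwise (fun S S' => S' ⊂ S) ∧ ∀ S ∈ l, S.Nonempty

/-- The translate of the span of a list of sets. -/
def piece (p : (X → ℕ) × List (Finset X)) : Set (X → ℕ) := {v | ∃ w ∈ layerSpan p.2, v = p.1 + w}

/-- A set of vectors is decomposable if it is a disjoint union of finitely many pieces, relative to
lists of sets with the property `C`. -/
def IsDecomposable (C : List (Finset X) → Prop) (Λ : Set (X → ℕ)) : Prop :=
  ∃ P : Finset ((X → ℕ) × List (Finset X)), (∀ p ∈ P, C p.2) ∧ (∀ p ∈ P, piece p ⊆ Λ) ∧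
    ∀ v ∈ Λ, ∃! p, p ∈ P ∧ v ∈ piece p

variable {C : List (Finset X) → Prop} {Λ Λ' : Set (X → ℕ)}

theorem zero_mem_layerSpan (l : List (Finset X)) : 0 ∈ layerSpan l := by
  induction l with
  | nil => rfl
  | cons S l ih => exact ⟨0, 0, ih, by simp⟩

theorem add_mem_layerSpan {l : List (Finset X)} {v w : X → ℕ} (hv : v ∈ layerSpan l)
    (hw : w ∈ layerSpan l) : v + w ∈ layerSpan l := by
  induction l generalizing v w with
  | nil =>
    rw [Set.mem_singleton_iff.1 hv, Set.mem_singleton_iff.1 hw]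
    rfl
  | cons S l ih =>
    obtain ⟨m, v, hv, rfl⟩ := hv
    obtain ⟨n, w, hw, rfl⟩ := hw
    exact ⟨m + n, v + w, ih hv hw, by rw [add_smul]; abel⟩

theorem ind_mem_layerSpan {l : List (Finset X)} {S : Finset X} (hS : S ∈ l) :
    ind S ∈ layerSpan l := by
  induction l with
  | nil => simp at hS
  | cons S' l ih =>
    rcases List.mem_cons.1 hS with rfl | hS
    · exact ⟨1, 0, zero_mem_layerSpan l, by simp⟩
    · exact ⟨0, ind S, ih hS, by simp⟩

theorem eq_zero_of_mem_layerSpan {l : List (Finset X)} {w : X → ℕ} {c : X}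
    (hw : w ∈ layerSpan l) (hc : ∀ S ∈ l, c ∉ S) : w c = 0 := by
  induction l generalizing w with
  | nil =>
    rw [Set.mem_singleton_iff.1 hw]
    rfl
  | cons S l ih =>
    obtain ⟨m, w, hw, rfl⟩ := hw
    simp [ih hw fun S' hS' => hc S' (List.mem_cons_of_mem _ hS'),
      ind_of_notMem (hc S (List.mem_cons_self ..))]

theorem IsLayerChain.of_cons {S : Finset X} {l : List (Finset X)} (h : IsLayerChain (S :: l)) :
    IsLayerChain l :=
  ⟨h.1.of_cons, fun S' hS' => h.2 S' (List.mem_cons_of_mem _ hS')⟩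

theorem IsLayerChain.sublist {l l' : List (Finset X)} (h : IsLayerChain l)
    (hl : l'.Sublist l) : IsLayerChain l' :=
  ⟨h.1.sublist hl, fun S hS => h.2 S (hl.subset hS)⟩

/-- The first set of a strictly decreasing list has an element that belongs to no other set. -/
theorem IsLayerChain.exists_mem {S : Finset X} {l : List (Finset X)}
    (h : IsLayerChain (S :: l)) : ∃ c ∈ S, ∀ w ∈ layerSpan l, w c = 0 := by
  obtain ⟨c, hcS, hc⟩ : ∃ c ∈ S, ∀ S' ∈ l, c ∉ S' := by
    cases l with
    | nil =>
      obtain ⟨c, hc⟩ := h.2 S (List.mem_cons_self ..)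
      exact ⟨c, hc, by simp⟩
    | cons S₁ l =>
      have h₁ := List.pairwise_cons.1 h.1
      have h₂ := List.pairwise_cons.1 h₁.2
      obtain ⟨c, hcS, hc⟩ := Finset.exists_of_ssubset (h₁.1 S₁ (List.mem_cons_self ..))
      refine ⟨c, hcS, fun S' hS' => ?_⟩
      rcases List.mem_cons.1 hS' with rfl | hS'
      · exact hc
      · exact fun hc' => hc ((h₂.1 S' hS').subset hc')
  exact ⟨c, hcS, fun w hw => eq_zero_of_mem_layerSpan hw hc⟩

/-- The coefficient of `S` is read at an element of `S` that belongs to no set of `l`. -/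
theorem IsLayerChain.smul_add_inj {S : Finset X} {l : List (Finset X)}
    (h : IsLayerChain (S :: l)) {m m' : ℕ} {w w' : X → ℕ} (hw : w ∈ layerSpan l)
    (hw' : w' ∈ layerSpan l) (heq : m • ind S + w = m' • ind S + w') : m = m' ∧ w = w' := by
  obtain ⟨c, hcS, hc⟩ := h.exists_mem
  have h₁ := congrFun heq c
  simp only [Pi.add_apply, Pi.smul_apply, ind_of_mem hcS, hc w hw, hc w' hw'] at h₁
  have h₂ : m = m' := by simpa using h₁
  subst h₂
  exact ⟨rfl, add_left_cancel heq⟩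

namespace IsDecomposable

theorem mono {C' : List (Finset X) → Prop} (h : IsDecomposable C Λ) (hC : ∀ l, C l → C' l) :
    IsDecomposable C' Λ := by
  obtain ⟨P, h₁, h₂⟩ := h
  exact ⟨P, fun p hp => hC _ (h₁ p hp), h₂⟩

theorem empty : IsDecomposable C (∅ : Set (X → ℕ)) := ⟨∅, by simp, by simp, by simp⟩

theorem union (h : IsDecomposable C Λ) (h' : IsDecomposable C Λ') (hd : Disjoint Λ Λ') :
    IsDecomposable C (Λ ∪ Λ') := by
  obtain ⟨P, h₁, h₂, h₃⟩ := h
  obtain ⟨P', h₁', h₂', h₃'⟩ := h'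
  refine ⟨P ∪ P', ?_, ?_, ?_⟩
  · intro p hp
    rcases Finset.mem_union.1 hp with hp | hp
    exacts [h₁ p hp, h₁' p hp]
  · intro p hp
    rcases Finset.mem_union.1 hp with hp | hp
    exacts [(h₂ p hp).trans Set.subset_union_left, (h₂' p hp).trans Set.subset_union_right]
  · rintro v (hv | hv)
    · obtain ⟨p, ⟨hp, hvp⟩, huniq⟩ := h₃ v hv
      refine ⟨p, ⟨Finset.mem_union_left _ hp, hvp⟩, ?_⟩
      rintro q ⟨hq, hvq⟩
      rcases Finset.mem_union.1 hq with hq | hq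
      · exact huniq q ⟨hq, hvq⟩
      · exact absurd (h₂' q hq hvq) (Set.disjoint_left.1 hd hv)
    · obtain ⟨p, ⟨hp, hvp⟩, huniq⟩ := h₃' v hv
      refine ⟨p, ⟨Finset.mem_union_right _ hp, hvp⟩, ?_⟩
      rintro q ⟨hq, hvq⟩
      rcases Finset.mem_union.1 hq with hq | hq
      · exact absurd hv (Set.disjoint_left.1 hd (h₂ q hq hvq))
      · exact huniq q ⟨hq, hvq⟩

theorem biUnion {ι : Type*} (s : Finset ι) (Λ : ι → Set (X → ℕ))
    (h : ∀ i ∈ s, IsDecomposable C (Λ i))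
    (hd : ∀ i ∈ s, ∀ j ∈ s, ∀ v ∈ Λ i, v ∈ Λ j → i = j) :
    IsDecomposable C (⋃ i ∈ s, Λ i) := by
  induction s using Finset.induction_on with
  | empty => simpa using empty
  | insert i s his ih =>
    rw [Finset.set_biUnion_insert]
    refine (h i (Finset.mem_insert_self _ _)).union
      (ih (fun j hj => h j (Finset.mem_insert_of_mem hj)) fun j hj k hk =>
        hd j (Finset.mem_insert_of_mem hj) k (Finset.mem_insert_of_mem hk)) ?_
    rw [Set.disjoint_left]
    intro v hv hv'
    simp only [Set.mem_iUnion] at hv'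
    obtain ⟨j, hj, hv'⟩ := hv'
    exact his (hd i (Finset.mem_insert_self _ _) j (Finset.mem_insert_of_mem hj) v hv hv' ▸ hj)

theorem image_add (b : X → ℕ) (h : IsDecomposable C Λ) :
    IsDecomposable C ((b + ·) '' Λ) := by
  obtain ⟨P, h₁, h₂, h₃⟩ := h
  refine ⟨P.image fun p => (b + p.1, p.2), ?_, ?_, ?_⟩
  · intro p hp
    obtain ⟨q, hq, rfl⟩ := Finset.mem_image.1 hp
    exact h₁ q hq
  · intro p hp
    obtain ⟨q, hq, rfl⟩ := Finset.mem_image.1 hp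
    rintro v ⟨w, hw, rfl⟩
    exact ⟨q.1 + w, h₂ q hq ⟨w, hw, rfl⟩, (add_assoc _ _ _).symm⟩
  · rintro _ ⟨v, hv, rfl⟩
    obtain ⟨p, ⟨hp, w, hw, rfl⟩, huniq⟩ := h₃ v hv
    refine ⟨(b + p.1, p.2), ⟨Finset.mem_image_of_mem _ hp, w, hw, (add_assoc _ _ _).symm⟩, ?_⟩
    rintro q ⟨hq, w', hw', hww'⟩
    obtain ⟨q, hq', rfl⟩ := Finset.mem_image.1 hq
    rw [huniq q ⟨hq', w', hw', add_left_cancel (hww'.trans (add_assoc _ _ _))⟩]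

/-- Adding to the lists of the pieces a set that contains all their sets strictly. -/
theorem cons {S : Finset X} {l : List (Finset X)} (hl : IsLayerChain (S :: l))
    (hΛ : Λ ⊆ layerSpan l) (h : IsDecomposable (fun l' => l'.Sublist l) Λ) :
    IsDecomposable (fun l' => l'.Sublist (S :: l)) {v | ∃ m : ℕ, ∃ w ∈ Λ, v = m • ind S + w} := by
  obtain ⟨P, h₁, h₂, h₃⟩ := h
  refine ⟨P.image fun p => (p.1, S :: p.2), ?_, ?_, ?_⟩
  · intro p hp
    obtain ⟨q, hq, rfl⟩ := Finset.mem_image.1 hp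
    exact (h₁ q hq).cons_cons S
  · intro p hp
    obtain ⟨q, hq, rfl⟩ := Finset.mem_image.1 hp
    rintro v ⟨w, ⟨m, w, hw, rfl⟩, rfl⟩
    exact ⟨m, q.1 + w, h₂ q hq ⟨w, hw, rfl⟩, add_left_comm _ _ _⟩
  · rintro _ ⟨m, w, hw, rfl⟩
    obtain ⟨p, ⟨hp, v, hv, rfl⟩, huniq⟩ := h₃ w hw
    refine ⟨(p.1, S :: p.2), ⟨Finset.mem_image_of_mem _ hp, m • ind S + v, ⟨m, v, hv, rfl⟩,
      add_left_comm _ _ _⟩, ?_⟩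
    rintro _ ⟨hq₀, hw'⟩
    obtain ⟨q, hq, rfl⟩ := Finset.mem_image.1 hq₀
    obtain ⟨w', ⟨m', v', hv', rfl⟩, hww'⟩ := hw'
    have hq' : q.1 + v' ∈ Λ := h₂ q hq ⟨v', hv', rfl⟩
    have := hl.smul_add_inj (hΛ hw) (hΛ hq') (hww'.trans (add_left_comm _ _ _))
    rw [huniq q ⟨hq, v', hv', this.2⟩]

end IsDecomposable

/-- The vectors of a span, parametrized by their coefficients. -/
theorem mem_layerSpan_iff {l : List (Finset X)} {v : X → ℕ} :
    v ∈ layerSpan l ↔ ∃ m : Fin l.length → ℕ, v = ∑ i, m i • ind (l.get i) := by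
  induction l generalizing v with
  | nil => simp [layerSpan]
  | cons S l ih =>
    constructor
    · rintro ⟨m, w, hw, rfl⟩
      obtain ⟨n, rfl⟩ := ih.1 hw
      refine ⟨Fin.cons m n, ?_⟩
      erw [Fin.sum_univ_succ]
      rfl
    · rintro ⟨m, rfl⟩
      refine ⟨m 0, _, ih.2 ⟨Fin.tail m, rfl⟩, ?_⟩
      erw [Fin.sum_univ_succ]
      rfl

/-- Dickson's lemma applied to the coefficient vectors: some term is below a later one, and the
difference of coefficients is again admissible. -/
theorem exists_add_of_sequence {l : List (Finset X)} (v : ℕ → X → ℕ)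
    (hv : ∀ n, v n ∈ layerSpan l) : ∃ i j, i < j ∧ ∃ w ∈ layerSpan l, v j = v i + w := by
  choose m hm using fun n => mem_layerSpan_iff.1 (hv n)
  obtain ⟨i, j, hij, hle⟩ := (wellQuasiOrdered_le (α := Fin l.length → ℕ)) m
  refine ⟨i, j, hij, _, mem_layerSpan_iff.2 ⟨m j - m i, rfl⟩, ?_⟩
  rw [hm, hm, ← Finset.sum_add_distrib]
  refine Finset.sum_congr rfl fun k _ => ?_
  rw [← add_smul, Pi.sub_apply, add_tsub_cancel_of_le (hle k)]

theorem add_mem_of_forall_ind {l : List (Finset X)} {Y : Set (X → ℕ)}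
    (hY : ∀ S ∈ l, ∀ y ∈ Y, y + ind S ∈ Y) {y w : X → ℕ} (hy : y ∈ Y) (hw : w ∈ layerSpan l) :
    y + w ∈ Y := by
  induction l generalizing y w with
  | nil => rwa [Set.mem_singleton_iff.1 hw, add_zero]
  | cons S l ih =>
    obtain ⟨m, w, hw, rfl⟩ := hw
    rw [add_left_comm, add_comm]
    have : y + w ∈ Y := ih (fun S' hS' => hY S' (List.mem_cons_of_mem _ hS')) hy hw
    induction m with
    | zero => simpa using this
    | succ m ihm =>
      rw [succ_nsmul, ← add_assoc]
      exact hY S (List.mem_cons_self ..) _ ihm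

/-- Ascending chain condition for the subsets of a span that are closed under addition of elements
of the span. -/
theorem exists_forall_eq_of_monotone {l : List (Finset X)} (Y : ℕ → Set (X → ℕ))
    (hmono : Monotone Y) (hYl : ∀ n, Y n ⊆ layerSpan l)
    (hY : ∀ n, ∀ S ∈ l, ∀ y ∈ Y n, y + ind S ∈ Y n) : ∃ n, ∀ m, n ≤ m → Y m = Y n := by
  by_contra! hcon
  have : ∀ n, ∃ m, n ≤ m ∧ ∃ y ∈ Y m, y ∉ Y n := by
    intro n
    obtain ⟨m, hnm, hne⟩ := hcon n
    exact ⟨m, hnm, Set.not_subset.1 fun h => hne (h.antisymm (hmono hnm))⟩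
  choose g hg y hy hyn using this
  -- The elements `y (s k)` lie in `Y (s (k + 1))` but not in `Y (s k)`. If `y (s j)` is `y (s i)`
  -- plus an element of the span, with `i < j`, it lies in `Y (s (i + 1)) ⊆ Y (s j)`, which is
  -- absurd.
  let s : ℕ → ℕ := fun k => g^[k] 0
  have hs : ∀ k, s (k + 1) = g (s k) := fun k => Function.iterate_succ_apply' g k 0
  have hsmono : Monotone s := monotone_nat_of_le_succ fun k => by rw [hs]; exact hg _
  obtain ⟨i, j, hij, w, hw, hvw⟩ := exists_add_of_sequence (fun k => y (s k))
    (fun k => hYl _ (hy (s k)))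
  refine hyn (s j) (hmono (hsmono (Nat.succ_le_of_lt hij)) ?_)
  rw [Nat.succ_eq_add_one, hs]
  rw [hvw]
  exact add_mem_of_forall_ind (hY _) (hy (s i)) hw

/-- Induction on the list. The slices of `Y` at the coefficient `n` of the head `S` increase with
`n` and stabilise, so `Y` is the disjoint union of finitely many slices and a cylinder in the
direction of `S`. -/
theorem isDecomposable_of_forall_ind {l : List (Finset X)} (hl : IsLayerChain l)
    {Y : Set (X → ℕ)} (hYl : Y ⊆ layerSpan l) (hY : ∀ S ∈ l, ∀ y ∈ Y, y + ind S ∈ Y) :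
    IsDecomposable (fun l' => l'.Sublist l) Y := by
  induction l generalizing Y with
  | nil =>
    by_cases h0 : (0 : X → ℕ) ∈ Y
    · have : Y = {0} := hYl.antisymm (Set.singleton_subset_iff.2 h0)
      subst this
      refine ⟨{(0, [])}, by simp, ?_, ?_⟩
      · intro p hp
        rw [Finset.mem_singleton.1 hp]
        rintro v ⟨w, hw, rfl⟩
        rw [zero_add]
        exact hw
      · intro v hv
        refine ⟨(0, []), ⟨by simp, v, hv, (zero_add v).symm⟩, fun q hq => ?_⟩
        simpa using hq.1
    · have : Y = ∅ := Set.eq_empty_of_forall_notMem fun y hy =>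
        h0 (by rwa [← Set.mem_singleton_iff.1 (hYl hy)])
      rw [this]
      exact IsDecomposable.empty
  | cons S l ih =>
    set Z : ℕ → Set (X → ℕ) := fun n => {w | w ∈ layerSpan l ∧ n • ind S + w ∈ Y} with hZ
    have hZl : ∀ n, Z n ⊆ layerSpan l := fun n w hw => hw.1
    have hZY : ∀ n, ∀ S' ∈ l, ∀ y ∈ Z n, y + ind S' ∈ Z n := by
      rintro n S' hS' y ⟨hy, hyY⟩
      refine ⟨?_, ?_⟩
      · exact add_mem_layerSpan hy (ind_mem_layerSpan hS')
      · rw [← add_assoc]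
        exact hY S' (List.mem_cons_of_mem _ hS') _ hyY
    have hmono : Monotone Z := monotone_nat_of_le_succ fun n w hw => ⟨hw.1, by
      rw [succ_nsmul, add_right_comm]
      exact hY S (List.mem_cons_self ..) _ hw.2⟩
    obtain ⟨n, hn⟩ := exists_forall_eq_of_monotone Z hmono hZl hZY
    have hdec : ∀ m, IsDecomposable (fun l' => l'.Sublist l) (Z m) := fun m =>
      ih hl.of_cons (hZl m) (hZY m)
    have hYeq : Y = (⋃ m ∈ Finset.range n, (m • ind S + ·) '' Z m) ∪
        (n • ind S + ·) '' {v | ∃ m : ℕ, ∃ w ∈ Z n, v = m • ind S + w} := by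
      ext v
      simp only [Set.mem_union, Set.mem_iUnion, Set.mem_image, Finset.mem_range]
      constructor
      · intro hv
        obtain ⟨m, w, hw, rfl⟩ := hYl hv
        have hwm : w ∈ Z m := ⟨hw, hv⟩
        rcases lt_or_ge m n with hmn | hnm
        · exact Or.inl ⟨m, hmn, w, hwm, rfl⟩
        · refine Or.inr ⟨(m - n) • ind S + w, ⟨m - n, w, hn m hnm ▸ hwm, rfl⟩, ?_⟩
          rw [← add_assoc, ← add_smul, add_tsub_cancel_of_le hnm]
      · rintro (⟨m, -, w, hw, rfl⟩ | ⟨_, ⟨m, w, hw, rfl⟩, rfl⟩)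
        · exact hw.2
        · rw [← add_assoc, ← add_smul]
          exact (hn (n + m) (Nat.le_add_right n m) ▸ hw : w ∈ Z (n + m)).2
    rw [hYeq]
    refine IsDecomposable.union (IsDecomposable.biUnion _ _ ?_ ?_)
      (IsDecomposable.image_add _ (IsDecomposable.cons hl (hZl n) (hdec n))) ?_
    · exact fun m _ => ((hdec m).mono fun l' hl' => hl'.cons S).image_add _
    · rintro m - m' - _ ⟨w, hw, rfl⟩ ⟨w', hw', heq⟩
      exact (hl.smul_add_inj (hZl _ hw') (hZl _ hw) heq).1.symm
    · rw [Set.disjoint_left]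
      intro v hv
      simp only [Set.mem_iUnion, Finset.mem_range] at hv
      obtain ⟨m, hmn, w, hw, rfl⟩ := hv
      rintro ⟨_, ⟨m', w', hw', rfl⟩, heq⟩
      simp only at heq
      rw [← add_assoc, ← add_smul] at heq
      have := (hl.smul_add_inj (hZl _ hw') (hZl _ hw) heq).1
      omega

/-- The sum of the indicator vectors of the sets of a list. -/
def layerSum (l : List (Finset X)) : X → ℕ := (l.map ind).sum

theorem layerSum_cons (S : Finset X) (l : List (Finset X)) :
    layerSum (S :: l) = ind S + layerSum l := by
  simp [layerSum]

/-- The offset `layerSum` makes all coefficients at least 1, so that the chain can be recovered from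
the vector. -/
theorem mem_piece_layerSum_cons {S : Finset X} {l : List (Finset X)} {v : X → ℕ} :
    v ∈ piece (layerSum (S :: l), S :: l) ↔
      ∃ m : ℕ, ∃ w ∈ piece (layerSum l, l), v = (m + 1) • ind S + w := by
  constructor
  · rintro ⟨_, ⟨m, w, hw, rfl⟩, rfl⟩
    refine ⟨m, _, ⟨w, hw, rfl⟩, ?_⟩
    simp only [layerSum_cons, add_smul, one_smul]
    abel
  · rintro ⟨m, _, ⟨w, hw, rfl⟩, rfl⟩
    refine ⟨_, ⟨m, w, hw, rfl⟩, ?_⟩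
    simp only [layerSum_cons, add_smul, one_smul]
    abel

theorem eq_zero_of_mem_piece_layerSum {l : List (Finset X)} {v : X → ℕ} {c : X}
    (hv : v ∈ piece (layerSum l, l)) (hc : ∀ S ∈ l, c ∉ S) : v c = 0 := by
  induction l generalizing v with
  | nil =>
    obtain ⟨w, hw, rfl⟩ := hv
    rw [Set.mem_singleton_iff.1 hw]
    rfl
  | cons S l ih =>
    obtain ⟨m, w, hw, rfl⟩ := mem_piece_layerSum_cons.1 hv
    simp [ih hw fun S' hS' => hc S' (List.mem_cons_of_mem _ hS'),
      ind_of_notMem (hc S (List.mem_cons_self ..))]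

theorem IsLayerChain.exists_mem_piece_eq_zero {S : Finset X} {l : List (Finset X)}
    (h : IsLayerChain (S :: l)) : ∃ c ∈ S, ∀ w ∈ piece (layerSum l, l), w c = 0 := by
  obtain ⟨c, hcS, hc⟩ := h.exists_mem
  refine ⟨c, hcS, fun w hw => eq_zero_of_mem_piece_layerSum hw fun S' hS' hcS' => ?_⟩
  have := hc _ (ind_mem_layerSpan hS')
  rw [ind_of_mem hcS'] at this
  exact one_ne_zero this

theorem IsLayerChain.pos_iff {S : Finset X} {l : List (Finset X)} (h : IsLayerChain (S :: l))
    {v : X → ℕ} (hv : v ∈ piece (layerSum (S :: l), S :: l)) (c : X) : v c ≠ 0 ↔ c ∈ S := by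
  constructor
  · intro hc
    by_contra hcS
    refine hc (eq_zero_of_mem_piece_layerSum hv fun S' hS' hcS' => ?_)
    rcases List.mem_cons.1 hS' with rfl | hS'
    · exact hcS hcS'
    · exact hcS (((List.pairwise_cons.1 h.1).1 S' hS').subset hcS')
  · intro hc
    obtain ⟨m, w, -, rfl⟩ := mem_piece_layerSum_cons.1 hv
    simp [ind_of_mem hc]

/-- The sets of the chain are superlevel sets of `v`: the threshold of `S` is one more than the sum
of the coefficients of the sets before it. Hence adding `ind S` is a bump. -/
theorem IsLayerChain.exists_threshold {l : List (Finset X)} (h : IsLayerChain l) {v : X → ℕ}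
    (hv : v ∈ piece (layerSum l, l)) {S : Finset X} (hS : S ∈ l) :
    ∃ k, 1 ≤ k ∧ ∀ c, k ≤ v c ↔ c ∈ S := by
  induction l generalizing v with
  | nil => simp at hS
  | cons S₀ l ih =>
    rcases List.mem_cons.1 hS with rfl | hSl
    · exact ⟨1, le_rfl, fun c => by rw [← h.pos_iff hv, Nat.one_le_iff_ne_zero]⟩
    · obtain ⟨m, w, hw, rfl⟩ := mem_piece_layerSum_cons.1 hv
      obtain ⟨k, hk, hkS⟩ := ih h.of_cons hw hSl
      refine ⟨m + 1 + k, by omega, fun c => ?_⟩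
      by_cases hc : c ∈ S₀
      · simp [ind_of_mem hc, hkS]
      · have h₁ : c ∉ S := fun h' => hc (((List.pairwise_cons.1 h.1).1 S hSl).subset h')
        have h₂ := (hkS c).not.2 h₁
        simp only [Pi.add_apply, Pi.smul_apply, ind_of_notMem hc, h₁, iff_false]
        simp
        omega

theorem IsLayerChain.eq_of_mem_piece {l l' : List (Finset X)} (h : IsLayerChain l)
    (h' : IsLayerChain l') {v : X → ℕ} (hv : v ∈ piece (layerSum l, l))
    (hv' : v ∈ piece (layerSum l', l')) : l = l' := by
  induction l generalizing l' v with
  | nil =>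
    cases l' with
    | nil => rfl
    | cons S' l' =>
      obtain ⟨c, hc⟩ := h'.2 S' (List.mem_cons_self ..)
      exact absurd (eq_zero_of_mem_piece_layerSum hv (by simp)) ((h'.pos_iff hv' c).2 hc)
  | cons S l ih =>
    cases l' with
    | nil =>
      obtain ⟨c, hc⟩ := h.2 S (List.mem_cons_self ..)
      exact absurd (eq_zero_of_mem_piece_layerSum hv' (by simp)) ((h.pos_iff hv c).2 hc)
    | cons S' l' =>
      have hSS' : S = S' := by
        ext c
        rw [← h.pos_iff hv, h'.pos_iff hv']
      subst hSS'
      obtain ⟨m, w, hw, rfl⟩ := mem_piece_layerSum_cons.1 hv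
      obtain ⟨m', w', hw', heq⟩ := mem_piece_layerSum_cons.1 hv'
      obtain ⟨c, hcS, hc⟩ := h.exists_mem_piece_eq_zero
      obtain ⟨c', hcS', hc'⟩ := h'.exists_mem_piece_eq_zero
      -- The entry at `c` gives `m' ≤ m`, the entry at `c'` gives `m ≤ m'`.
      have h₁ := congrFun heq c
      have h₂ := congrFun heq c'
      simp only [Pi.add_apply, Pi.smul_apply, ind_of_mem hcS, ind_of_mem hcS', hc w hw,
        hc' w' hw', smul_eq_mul, mul_one] at h₁ h₂
      have hmm' : m = m' := by omega
      subst hmm'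
      have hww' : w = w' := add_left_cancel heq
      subst hww'
      rw [ih h.of_cons h'.of_cons hw hw']

variable [Fintype X]

/-- Subtract from `v` the indicator of its support times its least nonzero value: the support
shrinks strictly and the sum of the entries drops. -/
theorem exists_isLayerChain_mem_piece (v : X → ℕ) :
    ∃ l, IsLayerChain l ∧ v ∈ piece (layerSum l, l) := by
  induction hn : ∑ c, v c using Nat.strong_induction_on generalizing v with
  | _ n ih =>
    by_cases hv : v = 0
    · exact ⟨[], ⟨List.Pairwise.nil, by simp⟩, 0, rfl, by rw [hv]; rfl⟩
    · set S : Finset X := Finset.univ.filter fun c => v c ≠ 0 with hS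
      have hSne : S.Nonempty := by
        obtain ⟨c, hc⟩ := Function.ne_iff.1 hv
        exact ⟨c, by simpa [hS] using hc⟩
      obtain ⟨c₀, hc₀, hmin⟩ := S.exists_min_image v hSne
      have hle : ∀ c, (v c₀ • ind S) c ≤ v c := by
        intro c
        by_cases hc : c ∈ S
        · simpa [ind_of_mem hc] using hmin c hc
        · simp [ind_of_notMem hc]
      have hpos : 0 < v c₀ := Nat.pos_of_ne_zero (Finset.mem_filter.1 hc₀).2
      have hvw : v = v c₀ • ind S + (v - v c₀ • ind S) := by
        ext c
        have := hle c
        simp only [Pi.add_apply, Pi.sub_apply]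
        omega
      set w := v - v c₀ • ind S with hw
      have hwc₀ : w c₀ = 0 := by
        have := congrFun hvw c₀
        simp only [Pi.add_apply, Pi.smul_apply, ind_of_mem hc₀, smul_eq_mul, mul_one] at this
        omega
      have hwv : ∀ c, w c ≤ v c := fun c => Nat.sub_le _ _
      have hlt : ∑ c, w c < n := by
        rw [← hn]
        exact Finset.sum_lt_sum (fun c _ => hwv c) ⟨c₀, Finset.mem_univ _, by omega⟩
      obtain ⟨l, hl, hwl⟩ := ih _ hlt w rfl
      refine ⟨S :: l, ⟨List.pairwise_cons.2 ⟨fun S' hS' => ?_, hl.1⟩, ?_⟩,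
        mem_piece_layerSum_cons.2 ⟨v c₀ - 1, w, hwl, ?_⟩⟩
      · obtain ⟨k, hk, hkS'⟩ := hl.exists_threshold hwl hS'
        refine (Finset.ssubset_iff_of_subset fun c hc => ?_).2 ⟨c₀, hc₀, fun hc => ?_⟩
        · have h₁ := (hkS' c).2 hc
          have h₂ := hwv c
          rw [hS, Finset.mem_filter]
          exact ⟨Finset.mem_univ _, by omega⟩
        · have h₁ := (hkS' c₀).2 hc
          omega
      · intro S' hS'
        rcases List.mem_cons.1 hS' with rfl | hS'
        exacts [hSne, hl.2 S' hS']
      · rwa [Nat.sub_add_cancel hpos]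

theorem finite_setOf_isLayerChain : {l : List (Finset X) | IsLayerChain l}.Finite := by
  have : {l : List (Finset X) | l.Nodup}.Finite :=
    Set.finite_coe_iff.1 (Finite.of_fintype {l : List (Finset X) // l.Nodup})
  refine this.subset fun l hl => ?_
  exact hl.1.imp fun h => h.ne'

/-- A set of vectors that is stable by adding layers is a finite disjoint union of pieces. -/
theorem isDecomposable_of_bump {Λ : Set (X → ℕ)} (hΛ : ∀ a ∈ Λ, ∀ h, 1 ≤ h → bump h a ∈ Λ) :
    IsDecomposable IsLayerChain Λ := by
  have hY : ∀ l, IsLayerChain l → IsDecomposable IsLayerChain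
      ((layerSum l + ·) '' {w | w ∈ layerSpan l ∧ layerSum l + w ∈ Λ}) := by
    intro l hl
    refine ((isDecomposable_of_forall_ind hl (fun w hw => hw.1) ?_).mono
      fun l' hl' => hl.sublist hl').image_add _
    rintro S hS w ⟨hw, hwΛ⟩
    refine ⟨add_mem_layerSpan hw (ind_mem_layerSpan hS), ?_⟩
    -- For the threshold `k` of `S`, `bump k` adds exactly `ind S`.
    obtain ⟨k, hk, hkS⟩ := hl.exists_threshold ⟨w, hw, rfl⟩ hS
    convert hΛ _ hwΛ k hk using 1
    ext c
    rw [← add_assoc, Pi.add_apply, bump, ind]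
    simp only [hkS]
    split_ifs <;> simp
  have := IsDecomposable.biUnion finite_setOf_isLayerChain.toFinset _
    (fun l hl => hY l (by simpa using hl)) (by
      rintro l hl l' hl' v ⟨w, hw, rfl⟩ ⟨w', hw', heq⟩
      exact IsLayerChain.eq_of_mem_piece (by simpa using hl) (by simpa using hl')
        ⟨w, hw.1, rfl⟩ ⟨w', hw'.1, heq.symm⟩)
  convert this using 1
  ext v
  simp only [Set.mem_iUnion]
  constructor
  · intro hv
    obtain ⟨l, hl, w, hw, rfl⟩ := exists_isLayerChain_mem_piece v
    exact ⟨l, by simpa using hl, w, ⟨hw, hv⟩, rfl⟩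
  · rintro ⟨l, -, w, hw, rfl⟩
    exact hw.2

end Layers

/-! ### One canonical vector for each type -/

section Canonical

open Classical

variable {E α X : Type*} [Fintype X] {t : Finset E → α} {π : E → X}

/-- The types are in bijection with a finite disjoint union of pieces of the set of vectors. -/
theorem exists_canonical_vectors
    (hπ : ∀ x y, π x = π y ↔ Interchangeable t Set.univ x y) (ht : IsHereditary t) :
    ∃ Ω : Set (X → ℕ), IsDecomposable IsLayerChain Ω ∧ (∀ v ∈ Ω, ∃ A, vec π A = v) ∧
      ∀ A, ∃! v, v ∈ Ω ∧ ∃ B, vec π B = v ∧ t B = t A := by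
  obtain ⟨n, u, Λ, hbump, hvec, huniq⟩ := exists_bump_closed_codes hπ ht
  refine ⟨⋃ i ∈ (Finset.univ : Finset (Fin n)), (u i + ·) '' Λ i, ?_, ?_, ?_⟩
  · refine IsDecomposable.biUnion _ _
      (fun i _ => (isDecomposable_of_bump (hbump i)).image_add _) ?_
    rintro i - j - v ⟨a, ha, rfl⟩ ⟨b, hb, heq⟩
    obtain ⟨A, hA⟩ := hvec i a ha
    have := (huniq A).unique (y₁ := (i, a)) (y₂ := (j, b)) ⟨ha, A, hA, rfl⟩
      ⟨hb, A, hA.trans heq.symm, rfl⟩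
    exact congrArg Prod.fst this
  · intro v hv
    simp only [Set.mem_iUnion] at hv
    obtain ⟨i, -, a, ha, rfl⟩ := hv
    exact hvec i a ha
  · intro A
    obtain ⟨⟨i, a⟩, ⟨ha, B, hB, hBA⟩, hu⟩ := huniq A
    refine ⟨u i + a, ⟨?_, B, hB, hBA⟩, ?_⟩
    · simp only [Set.mem_iUnion]
      exact ⟨i, Finset.mem_univ _, a, ha, rfl⟩
    · rintro v ⟨hv, C, hC, hCA⟩
      simp only [Set.mem_iUnion] at hv
      obtain ⟨j, -, b, hb, rfl⟩ := hv
      have := hu (j, b) ⟨hb, C, hC, hCA⟩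
      simp only [Prod.mk.injEq] at this
      obtain ⟨rfl, rfl⟩ := this
      rfl

end Canonical

/-! ### Regularity of the languages obtained by prefixing words and their powers -/

section Regular

open Classical

variable {σ : Type*}

/-- A language is regular as soon as it belongs to a finite set of languages whose quotients by
letters are unions of languages of this set. -/
theorem isRegular_of_finite_of_quotient {𝒮 : Set (Language σ)} (h𝒮 : 𝒮.Finite)
    (h : ∀ l ∈ 𝒮, ∀ a, ∃ T ⊆ 𝒮, ∀ y, a :: y ∈ l ↔ ∃ l' ∈ T, y ∈ l') {l : Language σ}
    (hl : l ∈ 𝒮) : l.IsRegular := by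
  -- Letter by letter, every left quotient is a union of members of the finite set `𝒮`. There are
  -- finitely many such unions, and Myhill–Nerode applies.
  have key : ∀ x : List σ, ∀ T ⊆ 𝒮, ∃ T' ⊆ 𝒮, ∀ y, (∃ l ∈ T, x ++ y ∈ l) ↔ ∃ l ∈ T', y ∈ l := by
    intro x
    induction x with
    | nil => exact fun T hT => ⟨T, hT, fun y => Iff.rfl⟩
    | cons a x ih =>
      intro T hT
      choose! D hD hDy using fun (l : Language σ) (hl : l ∈ 𝒮) => h l hl a
      obtain ⟨T', hT', hy⟩ := ih (⋃ l ∈ T, D l) (Set.iUnion₂_subset fun l hl => hD l (hT hl))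
      refine ⟨T', hT', fun y => ?_⟩
      rw [← hy]
      constructor
      · rintro ⟨l, hl, hxy⟩
        obtain ⟨l', hl', hxy'⟩ := (hDy l (hT hl) _).1 hxy
        exact ⟨l', Set.mem_biUnion hl hl', hxy'⟩
      · rintro ⟨l', hl', hxy'⟩
        obtain ⟨l, hl, hl'⟩ := Set.mem_iUnion₂.1 hl'
        exact ⟨l, hl, (hDy l (hT hl) _).2 ⟨l', hl', hxy'⟩⟩
  refine Language.IsRegular.of_finite_range_leftQuotient ((h𝒮.powerset.image
    fun T => ({y | ∃ l ∈ T, y ∈ l} : Language σ)).subset ?_)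
  rintro _ ⟨x, rfl⟩
  obtain ⟨T', hT', hy⟩ := key x {l} (Set.singleton_subset_iff.2 hl)
  refine ⟨T', hT', Set.ext fun y => ?_⟩
  have := hy y
  simp only [Set.mem_singleton_iff, exists_eq_left] at this
  exact this.symm

theorem isRegular_zero : (0 : Language σ).IsRegular :=
  isRegular_of_finite_of_quotient (𝒮 := {0}) (Set.finite_singleton _)
    (by
      rintro l rfl a
      exact ⟨∅, Set.empty_subset _, fun y => by simp [Language.notMem_zero]⟩) rfl

theorem isRegular_one : (1 : Language σ).IsRegular :=
  isRegular_of_finite_of_quotient (𝒮 := {1}) (Set.finite_singleton _)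
    (by
      rintro l rfl a
      exact ⟨∅, Set.empty_subset _, fun y => by simp [Language.mem_one]⟩) rfl

/-- The words of a language, preceded by a given word. -/
def wordMul (w : List σ) (l : Language σ) : Language σ := {x | ∃ y ∈ l, x = w ++ y}

/-- The words of a language, preceded by a power of a given word. -/
def starMul (w : List σ) (l : Language σ) : Language σ :=
  {x | ∃ n : ℕ, ∃ y ∈ l, x = (List.replicate n w).flatten ++ y}

theorem mem_wordMul {w x : List σ} {l : Language σ} : x ∈ wordMul w l ↔ ∃ y ∈ l, x = w ++ y :=
  Iff.rfl

theorem mem_starMul_iff {w x : List σ} {l : Language σ} :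
    x ∈ starMul w l ↔ x ∈ l ∨ x ∈ wordMul w (starMul w l) := by
  constructor
  · rintro ⟨n, y, hy, rfl⟩
    cases n with
    | zero => exact Or.inl (by simpa using hy)
    | succ n => exact Or.inr ⟨_, ⟨n, y, hy, rfl⟩, by simp [List.replicate_succ]⟩
  · rintro (h | ⟨_, ⟨n, y, hy, rfl⟩, rfl⟩)
    · exact ⟨0, x, h, by simp⟩
    · exact ⟨n + 1, y, hy, by simp [List.replicate_succ]⟩

theorem cons_mem_wordMul_cons {a b : σ} {s y : List σ} {l : Language σ} :
    a :: y ∈ wordMul (b :: s) l ↔ a = b ∧ y ∈ wordMul s l := by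
  simp only [mem_wordMul, List.cons_append, List.cons.injEq]
  tauto

theorem isRegular_wordMul {l : Language σ} (hl : l.IsRegular) (w : List σ) :
    (wordMul w l).IsRegular := by
  induction w with
  | nil =>
    convert hl using 1
    ext x
    simp [mem_wordMul]
  | cons b s ih =>
    refine isRegular_of_finite_of_quotient
      (𝒮 := insert (wordMul (b :: s) l) (Set.range (wordMul s l).leftQuotient))
      (ih.finite_range_leftQuotient.insert _) ?_ (Set.mem_insert _ _)
    rintro l' (rfl | ⟨x, rfl⟩) a
    · by_cases hab : a = b
      · exact ⟨{wordMul s l}, Set.singleton_subset_iff.2 (Or.inr ⟨[], rfl⟩),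
          fun y => by simp [cons_mem_wordMul_cons, hab]⟩
      · exact ⟨∅, Set.empty_subset _, fun y => by simp [cons_mem_wordMul_cons, hab]⟩
    · refine ⟨{(wordMul s l).leftQuotient (x ++ [a])},
        Set.singleton_subset_iff.2 (Or.inr ⟨_, rfl⟩), fun y => ?_⟩
      simp [Language.mem_leftQuotient]

/-- The finite family consists of $s\,w^*l$, for `s` a suffix of `w`, and of the left quotients of
`l`. A letter read shortens a nonempty suffix; at the empty suffix it either starts a word of `l` or
begins a new copy of `w`. -/
theorem isRegular_starMul {l : Language σ} (hl : l.IsRegular) {w : List σ} (hw : w ≠ []) :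
    (starMul w l).IsRegular := by
  obtain ⟨b, w', rfl⟩ := List.exists_cons_of_ne_nil hw
  set K := starMul (b :: w') l with hK
  have hnil : wordMul [] K = K := by
    ext x
    simp [mem_wordMul]
  refine isRegular_of_finite_of_quotient
    (𝒮 := ((fun s => wordMul s K) '' {s | s ∈ (b :: w').tails}) ∪ Set.range l.leftQuotient)
    (((List.finite_toSet _).image _).union hl.finite_range_leftQuotient) ?_
    (Or.inl ⟨[], by simp, hnil⟩)
  rintro l' (⟨s, hs, rfl⟩ | ⟨x, rfl⟩) a
  · have hs : s <:+ b :: w' := (List.mem_tails _ _).1 hs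
    cases s with
    | nil =>
      simp only [hnil]
      refine ⟨{l.leftQuotient [a]} ∪ (if a = b then {wordMul w' K} else ∅), ?_, fun y => ?_⟩
      · refine Set.union_subset (Set.singleton_subset_iff.2 (Or.inr ⟨_, rfl⟩)) ?_
        split_ifs
        · exact Set.singleton_subset_iff.2
            (Or.inl ⟨w', (List.mem_tails _ _).2 (List.suffix_cons b w'), rfl⟩)
        · exact Set.empty_subset _
      · rw [hK, mem_starMul_iff, cons_mem_wordMul_cons]
        by_cases hab : a = b
        · simp [hab, Language.mem_leftQuotient, or_comm]
        · simp [hab, Language.mem_leftQuotient]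
    | cons b' s =>
      by_cases hab : a = b'
      · refine ⟨{wordMul s K}, Set.singleton_subset_iff.2
          (Or.inl ⟨s, (List.mem_tails _ _).2 ((List.suffix_cons b' s).trans hs), rfl⟩),
          fun y => by simp [cons_mem_wordMul_cons, hab]⟩
      · exact ⟨∅, Set.empty_subset _, fun y => by simp [cons_mem_wordMul_cons, hab]⟩
  · refine ⟨{l.leftQuotient (x ++ [a])}, Set.singleton_subset_iff.2 (Or.inr ⟨_, rfl⟩),
      fun y => ?_⟩
    simp [Language.mem_leftQuotient]

end Regular

/-! ### Words coding spans and pieces -/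

section Words

open Classical

variable {X : Type*} [Fintype X]

/-- The vector of the numbers of occurrences of the letters of a word. -/
def countVec (w : List X) (c : X) : ℕ := w.count c

/-- A word with prescribed numbers of occurrences of the letters. -/
def wordOf (v : X → ℕ) : List X := (∑ c, Multiset.replicate (v c) c).toList

theorem countVec_wordOf (v : X → ℕ) : countVec (wordOf v) = v := by
  ext c
  rw [countVec, wordOf, ← Multiset.coe_count, Multiset.coe_toList, Multiset.count_sum']
  simp [Multiset.count_replicate]

omit [Fintype X] in
theorem countVec_append (w w' : List X) : countVec (w ++ w') = countVec w + countVec w' := by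
  ext c
  exact List.count_append ..

omit [Fintype X] in
theorem countVec_flatten_replicate (n : ℕ) (w : List X) :
    countVec (List.replicate n w).flatten = n • countVec w := by
  induction n with
  | zero => ext c; simp [countVec]
  | succ n ih => rw [List.replicate_succ, List.flatten_cons, countVec_append, ih, succ_nsmul']

/-- The words formed of powers of words given by a list of sets. -/
def spanLanguage : List (Finset X) → Language X
  | [] => 1
  | S :: l => starMul (wordOf (ind S)) (spanLanguage l)

theorem isRegular_spanLanguage {l : List (Finset X)} (hl : ∀ S ∈ l, S.Nonempty) :
    (spanLanguage l).IsRegular := by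
  induction l with
  | nil => exact isRegular_one
  | cons S l ih =>
    refine isRegular_starMul (ih fun S' hS' => hl S' (List.mem_cons_of_mem _ hS')) fun h => ?_
    obtain ⟨c, hc⟩ := hl S (List.mem_cons_self ..)
    have := congrFun (countVec_wordOf (ind S)) c
    rw [h, ind_of_mem hc] at this
    simp [countVec] at this

theorem countVec_mem_layerSpan {l : List (Finset X)} {w : List X} (hw : w ∈ spanLanguage l) :
    countVec w ∈ layerSpan l := by
  induction l generalizing w with
  | nil =>
    have : w = [] := hw
    subst this
    ext c
    simp [countVec]
  | cons S l ih =>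
    obtain ⟨n, y, hy, rfl⟩ := hw
    exact ⟨n, _, ih hy, by rw [countVec_append, countVec_flatten_replicate, countVec_wordOf]⟩

theorem exists_mem_spanLanguage {l : List (Finset X)} {v : X → ℕ} (hv : v ∈ layerSpan l) :
    ∃ w ∈ spanLanguage l, countVec w = v := by
  induction l generalizing v with
  | nil =>
    refine ⟨[], rfl, ?_⟩
    rw [Set.mem_singleton_iff.1 hv]
    ext c
    simp [countVec]
  | cons S l ih =>
    obtain ⟨m, v, hv, rfl⟩ := hv
    obtain ⟨w, hw, rfl⟩ := ih hv
    exact ⟨_, ⟨m, w, hw, rfl⟩,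
      by rw [countVec_append, countVec_flatten_replicate, countVec_wordOf]⟩

/-- The exponents of a word are the coefficients of its vector, which are unique along a chain. -/
theorem countVec_injOn_spanLanguage {l : List (Finset X)} (hl : IsLayerChain l) {w w' : List X}
    (hw : w ∈ spanLanguage l) (hw' : w' ∈ spanLanguage l) (h : countVec w = countVec w') :
    w = w' := by
  induction l generalizing w w' with
  | nil => exact (show w = [] from hw).trans (show w' = [] from hw').symm
  | cons S l ih =>
    obtain ⟨n, y, hy, rfl⟩ := hw
    obtain ⟨n', y', hy', rfl⟩ := hw'
    rw [countVec_append, countVec_append, countVec_flatten_replicate,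
      countVec_flatten_replicate, countVec_wordOf] at h
    obtain ⟨rfl, h₂⟩ := hl.smul_add_inj (countVec_mem_layerSpan hy) (countVec_mem_layerSpan hy') h
    rw [ih hl.of_cons hy hy' h₂]

/-- The words coding the elements of a finite union of pieces. -/
def pieceLanguage (P : Finset ((X → ℕ) × List (Finset X))) : Language X :=
  {w | ∃ p ∈ P, w ∈ wordMul (wordOf p.1) (spanLanguage p.2)}

theorem isRegular_pieceLanguage (P : Finset ((X → ℕ) × List (Finset X)))
    (hP : ∀ p ∈ P, IsLayerChain p.2) : (pieceLanguage P).IsRegular := by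
  induction P using Finset.induction_on with
  | empty =>
    have : pieceLanguage (∅ : Finset ((X → ℕ) × List (Finset X))) = 0 :=
      Set.eq_empty_of_forall_notMem fun w ⟨p, hp, _⟩ => Finset.notMem_empty p hp
    rw [this]
    exact isRegular_zero
  | insert p P hp ih =>
    have : pieceLanguage (insert p P) =
        wordMul (wordOf p.1) (spanLanguage p.2) + pieceLanguage P :=
      Set.ext fun w => Finset.exists_mem_insert ..
    rw [this]
    exact (isRegular_wordMul (isRegular_spanLanguage (hP p (Finset.mem_insert_self _ _)).2)
      (wordOf p.1)).add (ih fun q hq => hP q (Finset.mem_insert_of_mem hq))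

/-- A finite disjoint union of pieces is coded by a regular language. -/
theorem IsDecomposable.exists_isRegular {Ω : Set (X → ℕ)} (hΩ : IsDecomposable IsLayerChain Ω) :
    ∃ W : Language X, W.IsRegular ∧ (∀ w ∈ W, countVec w ∈ Ω) ∧
      ∀ v ∈ Ω, ∃! w, w ∈ W ∧ countVec w = v := by
  obtain ⟨P, hP, hPΩ, huniq⟩ := hΩ
  have hcount : ∀ p ∈ P, ∀ w ∈ wordMul (wordOf p.1) (spanLanguage p.2), countVec w ∈ piece p := by
    rintro p hp _ ⟨y, hy, rfl⟩
    exact ⟨_, countVec_mem_layerSpan hy, by rw [countVec_append, countVec_wordOf]⟩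
  refine ⟨pieceLanguage P, ?_, ?_, ?_⟩
  · exact isRegular_pieceLanguage P hP
  · rintro w ⟨p, hp, hw⟩
    exact hPΩ p hp (hcount p hp w hw)
  · intro v hv
    obtain ⟨p, ⟨hp, y, hy, rfl⟩, hpu⟩ := huniq v hv
    obtain ⟨w, hw, rfl⟩ := exists_mem_spanLanguage hy
    refine ⟨wordOf p.1 ++ w, ⟨⟨p, hp, w, hw, rfl⟩, by rw [countVec_append, countVec_wordOf]⟩, ?_⟩
    rintro w' ⟨⟨q, hq, hw'⟩, hcw'⟩
    have hqp : q = p := hpu q ⟨hq, hcw' ▸ hcount q hq w' hw'⟩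
    subst hqp
    obtain ⟨y', hy', rfl⟩ := hw'
    rw [countVec_append, countVec_wordOf] at hcw'
    rw [countVec_injOn_spanLanguage (hP q hq) hy' hw (add_left_cancel hcw')]

end Words

/-! ### Generating series of pieces -/

section Series

open Classical

variable {X : Type*} [Fintype X]

theorem finite_setOf_sum_eq (n : ℕ) : {v : X → ℕ | ∑ c, v c = n}.Finite := by
  refine (Set.finite_Iic (fun _ : X => n)).subset fun v hv c => ?_
  rw [← (hv : ∑ c, v c = n)]
  exact Finset.single_le_sum (f := v) (fun _ _ => Nat.zero_le _) (Finset.mem_univ c)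

/-- The number of vectors of a set with a given sum. -/
def sumCount (Λ : Set (X → ℕ)) (n : ℕ) : ℕ := {v | v ∈ Λ ∧ ∑ c, v c = n}.ncard

/-- The generating series of a set of vectors, graded by their sums. -/
def sumSeries (Λ : Set (X → ℕ)) : ℤ⟦X⟧ := PowerSeries.mk fun n => (sumCount Λ n : ℤ)

theorem sumSeries_union {Λ Λ' : Set (X → ℕ)} (h : Disjoint Λ Λ') :
    sumSeries (Λ ∪ Λ') = sumSeries Λ + sumSeries Λ' := by
  ext n
  simp only [sumSeries, PowerSeries.coeff_mk, map_add, sumCount]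
  rw [← Nat.cast_add, ← Set.ncard_union_eq
    (Set.disjoint_left.2 fun v hv hv' => Set.disjoint_left.1 h hv.1 hv'.1)
    ((finite_setOf_sum_eq n).subset fun v hv => hv.2)
    ((finite_setOf_sum_eq n).subset fun v hv => hv.2)]
  congr 2
  ext v
  simp only [Set.mem_ofPred_eq, Set.mem_union]
  tauto

theorem sumSeries_biUnion {ι : Type*} (s : Finset ι) (Λ : ι → Set (X → ℕ))
    (hd : ∀ i ∈ s, ∀ j ∈ s, ∀ v ∈ Λ i, v ∈ Λ j → i = j) :
    sumSeries (⋃ i ∈ s, Λ i) = ∑ i ∈ s, sumSeries (Λ i) := by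
  induction s using Finset.induction_on with
  | empty =>
    ext n
    simp [sumSeries, sumCount]
  | insert i s his ih =>
    rw [Finset.set_biUnion_insert, Finset.sum_insert his, sumSeries_union, ih]
    · exact fun j hj k hk =>
        hd j (Finset.mem_insert_of_mem hj) k (Finset.mem_insert_of_mem hk)
    · rw [Set.disjoint_left]
      intro v hv hv'
      simp only [Set.mem_iUnion] at hv'
      obtain ⟨j, hj, hv'⟩ := hv'
      exact his (hd i (Finset.mem_insert_self _ _) j (Finset.mem_insert_of_mem hj) v hv hv' ▸ hj)

theorem sumSeries_image_add (b : X → ℕ) (Λ : Set (X → ℕ)) :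
    sumSeries ((b + ·) '' Λ) = PowerSeries.X ^ (∑ c, b c) * sumSeries Λ := by
  ext n
  rw [PowerSeries.coeff_X_pow_mul']
  simp only [sumSeries, PowerSeries.coeff_mk, sumCount]
  have hsum : ∀ v : X → ℕ, ∑ c, (b + v) c = ∑ c, b c + ∑ c, v c := fun v => by
    simp [Finset.sum_add_distrib]
  split_ifs with h
  · congr 1
    rw [← Set.ncard_image_of_injective {v | v ∈ Λ ∧ ∑ c, v c = n - ∑ c, b c}
      (add_right_injective b)]
    congr 1
    ext v
    constructor
    · rintro ⟨⟨w, hw, rfl⟩, hv⟩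
      refine ⟨w, ⟨hw, ?_⟩, rfl⟩
      have := hsum w
      simp only at hv
      omega
    · rintro ⟨w, ⟨hw, hv⟩, rfl⟩
      refine ⟨⟨w, hw, rfl⟩, ?_⟩
      have := hsum w
      simp only
      omega
  · rw [Nat.cast_eq_zero, Set.ncard_eq_zero
      ((finite_setOf_sum_eq n).subset fun v hv => hv.2)]
    refine Set.eq_empty_of_forall_notMem ?_
    rintro v ⟨⟨w, hw, rfl⟩, hv⟩
    have := hsum w
    simp only at hv
    omega

theorem sum_ind (S : Finset X) : ∑ c, ind S c = S.card := by
  simp [ind]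

/-- The span of `S :: l` is the disjoint union of the span of `l` and of its own translate by `ind
S`, so multiplying its series by $1-Z^{|S|}$ gives that of `l`. -/
theorem sumSeries_layerSpan {l : List (Finset X)} (hl : IsLayerChain l) :
    sumSeries (layerSpan l) * (l.map fun S => (1 - PowerSeries.X ^ S.card : ℤ⟦X⟧)).prod = 1 := by
  induction l with
  | nil =>
    ext n
    simp only [layerSpan, List.map_nil, List.prod_nil, mul_one, sumSeries, PowerSeries.coeff_mk,
      sumCount, PowerSeries.coeff_one, Set.mem_singleton_iff]
    split_ifs with h
    · subst h
      rw [Nat.cast_eq_one, Set.ncard_eq_one]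
      refine ⟨0, Set.ext fun v => ⟨fun hv => hv.1, ?_⟩⟩
      rintro rfl
      simp
    · rw [Nat.cast_eq_zero, Set.ncard_eq_zero
        ((finite_setOf_sum_eq n).subset fun v hv => hv.2)]
      refine Set.eq_empty_of_forall_notMem ?_
      rintro v ⟨rfl, hv⟩
      simp only [Pi.zero_apply, Finset.sum_const_zero] at hv
      exact h hv.symm
  | cons S l ih =>
    have h₁ : layerSpan (S :: l) = layerSpan l ∪ (ind S + ·) '' layerSpan (S :: l) := by
      ext v
      constructor
      · rintro ⟨m, w, hw, rfl⟩
        cases m with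
        | zero => exact Or.inl (by simpa using hw)
        | succ m => exact Or.inr ⟨_, ⟨m, w, hw, rfl⟩, by rw [succ_nsmul', add_assoc]⟩
      · rintro (hv | ⟨_, ⟨m, w, hw, rfl⟩, rfl⟩)
        · exact ⟨0, v, hv, by simp⟩
        · exact ⟨m + 1, w, hw, by rw [succ_nsmul', add_assoc]⟩
    have h₂ : Disjoint (layerSpan l) ((ind S + ·) '' layerSpan (S :: l)) := by
      rw [Set.disjoint_left]
      rintro _ hv ⟨_, ⟨m, w, hw, rfl⟩, rfl⟩
      obtain ⟨c, hcS, hc⟩ := hl.exists_mem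
      have := hc _ hv
      simp [ind_of_mem hcS] at this
    have h₃ : sumSeries (layerSpan (S :: l)) * (1 - PowerSeries.X ^ S.card) =
        sumSeries (layerSpan l) := by
      have h := congrArg sumSeries h₁
      rw [sumSeries_union h₂, sumSeries_image_add, sum_ind] at h
      rw [mul_sub, mul_one, mul_comm _ (PowerSeries.X ^ S.card), sub_eq_iff_eq_add]
      exact h
    rw [List.map_cons, List.prod_cons, ← mul_assoc, h₃, ih hl.of_cons]

omit [Fintype X] in
-- Distinct sizes make the denominator of a piece a product of distinct factors of
-- $(1-Z)\cdots(1-Z^k)$.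
theorem IsLayerChain.nodup_map_card {l : List (Finset X)} (hl : IsLayerChain l) :
    (l.map Finset.card).Nodup := by
  rw [List.nodup_iff_pairwise_ne, List.pairwise_map]
  exact hl.1.imp fun h => (Finset.card_lt_card h).ne'

/-- The numerator of the generating series of a finite disjoint union of pieces. -/
def numerator (k : ℕ) (P : Finset ((X → ℕ) × List (Finset X))) : ℤ[X] :=
  ∑ p ∈ P, Polynomial.X ^ (∑ c, p.1 c) *
    ∏ i ∈ Finset.Icc 1 k \ (p.2.map Finset.card).toFinset, (1 - Polynomial.X ^ i)

theorem sumSeries_mul_prod {k : ℕ} {Ω : Set (X → ℕ)} {P : Finset ((X → ℕ) × List (Finset X))}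
    (hP : ∀ p ∈ P, IsLayerChain p.2) (hk : ∀ p ∈ P, ∀ S ∈ p.2, S.card ≤ k)
    (hPΩ : ∀ p ∈ P, piece p ⊆ Ω) (huniq : ∀ v ∈ Ω, ∃! p, p ∈ P ∧ v ∈ piece p) :
    sumSeries Ω * ∏ i ∈ Finset.Icc 1 k, (1 - (PowerSeries.X : ℤ⟦X⟧) ^ i) =
      (numerator k P : ℤ⟦X⟧) := by
  have hΩ : Ω = ⋃ p ∈ P, piece p := by
    ext v
    simp only [Set.mem_iUnion, exists_prop]
    exact ⟨fun hv => (huniq v hv).exists, fun ⟨p, hp, hv⟩ => hPΩ p hp hv⟩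
  have hpiece : ∀ p : (X → ℕ) × List (Finset X), piece p = (p.1 + ·) '' layerSpan p.2 := by
    intro p
    ext v
    constructor
    · rintro ⟨w, hw, rfl⟩
      exact ⟨w, hw, rfl⟩
    · rintro ⟨w, hw, rfl⟩
      exact ⟨w, hw, rfl⟩
  rw [hΩ, sumSeries_biUnion _ _ fun p hp q hq v hv hv' =>
    (huniq v (hPΩ p hp hv)).unique ⟨hp, hv⟩ ⟨hq, hv'⟩, Finset.sum_mul]
  have hcoe : (numerator k P : ℤ⟦X⟧) = ∑ p ∈ P, PowerSeries.X ^ (∑ c, p.1 c) *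
      ∏ i ∈ Finset.Icc 1 k \ (p.2.map Finset.card).toFinset, (1 - PowerSeries.X ^ i) := by
    rw [← Polynomial.coeToPowerSeries.ringHom_apply, numerator, map_sum]
    refine Finset.sum_congr rfl fun p _ => ?_
    rw [map_mul, map_pow, map_prod]
    congr 1
    · simp
    · refine Finset.prod_congr rfl fun i _ => ?_
      simp
  rw [hcoe]
  refine Finset.sum_congr rfl fun p hp => ?_
  have hsub : (p.2.map Finset.card).toFinset ⊆ Finset.Icc 1 k := by
    intro i hi
    obtain ⟨S, hS, rfl⟩ := List.mem_map.1 (List.mem_toFinset.1 hi)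
    exact Finset.mem_Icc.2 ⟨Finset.card_pos.2 ((hP p hp).2 S hS), hk p hp S hS⟩
  have hprod : (p.2.map fun S => (1 - PowerSeries.X ^ S.card : ℤ⟦X⟧)).prod =
      ∏ i ∈ (p.2.map Finset.card).toFinset, (1 - PowerSeries.X ^ i) := by
    rw [List.prod_toFinset _ (hP p hp).nodup_map_card, List.map_map]
    rfl
  rw [hpiece, sumSeries_image_add, ← Finset.prod_sdiff hsub, ← hprod, mul_assoc,
    mul_left_comm (sumSeries _), sumSeries_layerSpan (hP p hp), mul_one]

/-- At 1 a piece contributes 1 if its layer sizes exhaust `1, …, k`, and 0 otherwise because a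
factor `1 - X ^ i` remains. No cancellation can occur. -/
theorem numerator_eval_pos {k : ℕ} {P : Finset ((X → ℕ) × List (Finset X))}
    {p : (X → ℕ) × List (Finset X)} (hp : p ∈ P) (hchain : IsLayerChain p.2)
    (hk : ∀ S ∈ p.2, S.card ≤ k) (hlen : k ≤ p.2.length) : 0 < (numerator k P).eval 1 := by
  rw [numerator, Polynomial.eval_finsetSum]
  have hterm : ∀ q : (X → ℕ) × List (Finset X),
      (Polynomial.X ^ (∑ c, q.1 c) * ∏ i ∈ Finset.Icc 1 k \ (q.2.map Finset.card).toFinset,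
        (1 - Polynomial.X ^ i) : ℤ[X]).eval 1 =
      if Finset.Icc 1 k \ (q.2.map Finset.card).toFinset = ∅ then 1 else 0 := by
    intro q
    rw [Polynomial.eval_mul, Polynomial.eval_prod]
    split_ifs with h
    · simp [h]
    · obtain ⟨i, hi⟩ := Finset.nonempty_iff_ne_empty.2 h
      rw [Finset.prod_eq_zero hi (by simp), mul_zero]
  simp only [hterm]
  refine Finset.sum_pos' (fun q _ => by split_ifs <;> simp) ⟨p, hp, ?_⟩
  rw [if_pos]
  · exact one_pos
  · rw [Finset.sdiff_eq_empty_iff_subset]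
    refine (Finset.eq_of_subset_of_card_le (t := Finset.Icc 1 k) (fun i hi => ?_) ?_).symm.subset
    · obtain ⟨S, hS, rfl⟩ := List.mem_map.1 (List.mem_toFinset.1 hi)
      exact Finset.mem_Icc.2 ⟨Finset.card_pos.2 (hchain.2 S hS), hk S hS⟩
    · rw [List.toFinset_card_of_nodup hchain.nodup_map_card]
      simpa using hlen

end Series

/-! ### Growth of the coefficients -/

section Asymptotics

/-- A Stolz–Cesàro argument with step `i`. -/
theorem tendsto_div_pow_of_sub_tendsto_zero {e : ℕ → ℝ} {i j : ℕ} (hi : 1 ≤ i)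
    (h : Tendsto (fun n : ℕ => (e (n + i) - e n) / (n : ℝ) ^ j) atTop (𝓝 0)) :
    Tendsto (fun n : ℕ => e n / (n : ℝ) ^ (j + 1)) atTop (𝓝 0) := by
  rw [Metric.tendsto_atTop] at h ⊢
  intro ε hε
  obtain ⟨N₀, hN₀⟩ := h (ε / 4) (by positivity)
  -- Starting at `N₀ + 1` keeps the indices positive; `K` bounds the values of `|e|` that start the
  -- recursion.
  set N := N₀ + 1 with hN
  set K := ∑ m ∈ Finset.range (N + i), |e m| with hK
  have hK0 : 0 ≤ K := Finset.sum_nonneg fun _ _ => abs_nonneg _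
  have key : ∀ n, N ≤ n → |e n| ≤ K + ε / 4 * (n : ℝ) ^ (j + 1) := by
    intro n
    induction n using Nat.strong_induction_on with
    | _ n ih =>
      intro hn
      rcases lt_or_ge n (N + i) with hlt | hge
      · have h₁ : |e n| ≤ K := Finset.single_le_sum (f := fun m => |e m|)
          (fun _ _ => abs_nonneg _) (Finset.mem_range.2 hlt)
        have h₂ : 0 ≤ ε / 4 * (n : ℝ) ^ (j + 1) := by positivity
        linarith
      · obtain ⟨m, rfl⟩ : ∃ m, n = m + i := ⟨n - i, by omega⟩
        have hm : N ≤ m := by omega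
        have h₁ := ih m (by omega) hm
        have h₂ := hN₀ m (by omega)
        have hm0 : (0 : ℝ) < m := by exact_mod_cast (by omega : 0 < m)
        rw [dist_zero_right, Real.norm_eq_abs, abs_div, abs_of_pos (pow_pos hm0 j),
          div_lt_iff₀ (pow_pos hm0 j)] at h₂
        have h₃ : |e (m + i)| ≤ |e m| + |e (m + i) - e m| := by
          have := abs_add_le (e m) (e (m + i) - e m)
          rwa [add_sub_cancel] at this
        -- This inequality absorbs the increment `ε / 4 * m ^ j` into the bound at `m + i`.
        have h₄ : (m : ℝ) ^ (j + 1) + (m : ℝ) ^ j ≤ ((m + i : ℕ) : ℝ) ^ (j + 1) := by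
          have hle : (m : ℝ) + 1 ≤ ((m + i : ℕ) : ℝ) := by
            exact_mod_cast (by omega : m + 1 ≤ m + i)
          calc (m : ℝ) ^ (j + 1) + (m : ℝ) ^ j = (m : ℝ) ^ j * (m + 1) := by ring
            _ ≤ ((m + i : ℕ) : ℝ) ^ j * ((m + i : ℕ) : ℝ) := by
                gcongr
                omega
            _ = _ := (pow_succ _ _).symm
        have h₅ := mul_le_mul_of_nonneg_left h₄ (by positivity : (0 : ℝ) ≤ ε / 4)
        linarith
  obtain ⟨N₁, hN₁⟩ := exists_nat_gt (K / (ε / 4))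
  refine ⟨max N N₁, fun n hn => ?_⟩
  have hnN : N ≤ n := (le_max_left _ _).trans hn
  have hn1 : (1 : ℝ) ≤ n := by exact_mod_cast (by omega : 1 ≤ n)
  have hpow : (n : ℝ) ≤ (n : ℝ) ^ (j + 1) := le_self_pow₀ hn1 (by omega)
  have hKn : K ≤ ε / 4 * (n : ℝ) ^ (j + 1) := by
    have h₁ : K / (ε / 4) < n := hN₁.trans_le (by exact_mod_cast (le_max_right _ _).trans hn)
    rw [div_lt_iff₀ (by positivity)] at h₁
    have h₂ := mul_le_mul_of_nonneg_left hpow (by positivity : (0 : ℝ) ≤ ε / 4)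
    linarith
  have hpos : (0 : ℝ) < (n : ℝ) ^ (j + 1) := by positivity
  rw [dist_zero_right, Real.norm_eq_abs, abs_div, abs_of_pos hpos, div_lt_iff₀ hpos]
  have := key n hnN
  nlinarith [mul_pos hε hpos]

/-- This is the derivative at 0 of `x ↦ (1 + x * i) ^ (j + 1)`, taken along `x = 1 / n`. -/
theorem tendsto_sub_pow_div_pow (i j : ℕ) :
    Tendsto (fun n : ℕ => (((n + i : ℕ) : ℝ) ^ (j + 1) - (n : ℝ) ^ (j + 1)) / (n : ℝ) ^ j)
      atTop (𝓝 ((j + 1) * i)) := by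
  have hd : HasDerivAt (fun x : ℝ => (1 + x * i) ^ (j + 1)) ((j + 1) * i) 0 := by
    have h₁ : HasDerivAt (fun x : ℝ => 1 + x * i) (i : ℝ) 0 := by
      simpa using ((hasDerivAt_id (0 : ℝ)).mul_const (i : ℝ)).const_add 1
    simpa using h₁.fun_pow (j + 1)
  have h₀ : Tendsto (fun n : ℕ => (n : ℝ)⁻¹) atTop (𝓝[≠] 0) := by
    refine tendsto_nhdsWithin_iff.2 ⟨tendsto_inv_atTop_zero.comp tendsto_natCast_atTop_atTop, ?_⟩
    filter_upwards [eventually_gt_atTop 0] with n hn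
    exact inv_ne_zero (by exact_mod_cast hn.ne')
  refine (hd.tendsto_slope_zero.comp h₀).congr' ?_
  filter_upwards [eventually_gt_atTop 0] with n hn
  have hn' : (n : ℝ) ≠ 0 := by exact_mod_cast hn.ne'
  simp only [Function.comp_apply, inv_inv, zero_add, zero_mul, add_zero, one_pow, smul_eq_mul]
  have h₁ : 1 + (n : ℝ)⁻¹ * i = ((n + i : ℕ) : ℝ) / n := by
    push_cast
    field_simp
  rw [h₁, div_pow]
  field_simp
  ring

/-- With `b = a / (i * (j + 1))`, the increments of step `i` of `b * n ^ (j + 1)` match those of `g`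
to leading order, so the difference is negligible. -/
theorem tendsto_div_pow_of_add_eq {f g : ℕ → ℝ} {i j : ℕ} {a : ℝ} (hi : 1 ≤ i)
    (hfg : ∀ n, g (n + i) = g n + f (n + i))
    (hf : Tendsto (fun n : ℕ => f n / (n : ℝ) ^ j) atTop (𝓝 a)) :
    Tendsto (fun n : ℕ => g n / (n : ℝ) ^ (j + 1)) atTop (𝓝 (a / (i * (j + 1)))) := by
  set b := a / (i * (j + 1)) with hb
  have hi0 : (i : ℝ) ≠ 0 := by exact_mod_cast (by omega : i ≠ 0)
  have hj0 : (j : ℝ) + 1 ≠ 0 := by positivity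
  have hratio : Tendsto (fun n : ℕ => (((n + i : ℕ) : ℝ) / n) ^ j) atTop (𝓝 1) := by
    have h₁ : Tendsto (fun n : ℕ => 1 + (i : ℝ) / n) atTop (𝓝 (1 + 0)) :=
      tendsto_const_nhds.add (tendsto_const_div_atTop_nhds_zero_nat _)
    have h₂ := h₁.pow j
    rw [add_zero, one_pow] at h₂
    refine h₂.congr' ?_
    filter_upwards [eventually_gt_atTop 0] with n hn
    have hn' : (n : ℝ) ≠ 0 := by exact_mod_cast hn.ne'
    congr 1
    push_cast
    field_simp
  have hf' : Tendsto (fun n : ℕ => f (n + i) / (n : ℝ) ^ j) atTop (𝓝 a) := by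
    have h₁ := (((tendsto_add_atTop_iff_nat i).2 hf).mul hratio)
    rw [mul_one] at h₁
    refine h₁.congr' ?_
    filter_upwards [eventually_gt_atTop 0] with n hn
    have hn' : (n : ℝ) ≠ 0 := by exact_mod_cast hn.ne'
    have hn'' : ((n + i : ℕ) : ℝ) ≠ 0 := by exact_mod_cast (by omega : n + i ≠ 0)
    rw [div_pow]
    field_simp
  have he := tendsto_div_pow_of_sub_tendsto_zero (e := fun n => g n - b * (n : ℝ) ^ (j + 1))
    (j := j) hi (by
      have h₁ := hf'.sub ((tendsto_sub_pow_div_pow i j).const_mul b)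
      have h₂ : a - b * ((j + 1) * i) = 0 := by
        rw [hb]
        field_simp
        ring
      rw [h₂] at h₁
      refine h₁.congr fun n => ?_
      rw [hfg]
      ring)
  have := he.add_const b
  rw [zero_add] at this
  refine this.congr' ?_
  filter_upwards [eventually_gt_atTop 0] with n hn
  have hn' : (n : ℝ) ≠ 0 := by exact_mod_cast hn.ne'
  field_simp
  ring

theorem coeff_add_of_mul_one_sub {F G : ℤ⟦X⟧} {i : ℕ} (h : F * (1 - PowerSeries.X ^ i) = G)
    (n : ℕ) : PowerSeries.coeff (n + i) F = PowerSeries.coeff n F + PowerSeries.coeff (n + i) G := by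
  rw [← h, mul_sub, mul_one, map_sub, PowerSeries.coeff_mul_X_pow]
  ring

/-- The growth rate of the coefficients of a series whose denominator is `(1-Z)⋯(1-Z^m)`. -/
theorem exists_tendsto_coeff_div_pow {m : ℕ} (hm : 1 ≤ m) {P : ℤ[X]} (hP : 0 < P.eval 1)
    (F : ℤ⟦X⟧) (hF : F * ∏ i ∈ Finset.Icc 1 m, (1 - (PowerSeries.X : ℤ⟦X⟧) ^ i) = (P : ℤ⟦X⟧)) :
    ∃ a : ℝ, 0 < a ∧ Tendsto (fun n : ℕ => ((PowerSeries.coeff n F : ℤ) : ℝ) / (n : ℝ) ^ (m - 1))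
      atTop (𝓝 a) := by
  induction m, hm using Nat.le_induction generalizing F with
  | base =>
    rw [Finset.Icc_self, Finset.prod_singleton] at hF
    -- For one factor, the coefficients are the partial sums of those of `P`, equal to `P.eval 1`
    -- from the degree on.
    have hcoeff : ∀ n, PowerSeries.coeff n F = ∑ i ∈ Finset.range (n + 1), P.coeff i := by
      intro n
      induction n with
      | zero =>
        have := congrArg (PowerSeries.coeff 0) hF
        simpa [mul_sub] using this
      | succ n ih =>
        rw [coeff_add_of_mul_one_sub hF n, ih, Finset.sum_range_succ _ (n + 1),
          Polynomial.coeff_coe]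
    refine ⟨((P.eval 1 : ℤ) : ℝ), by exact_mod_cast hP, ?_⟩
    refine tendsto_const_nhds.congr' ?_
    filter_upwards [eventually_ge_atTop P.natDegree] with n hn
    rw [hcoeff, Polynomial.eval_eq_sum_range' (Nat.lt_succ_of_le hn)]
    simp
  | succ m hm ih =>
    rw [Finset.prod_Icc_succ_top (by omega), mul_comm (∏ i ∈ Finset.Icc 1 m, _), ← mul_assoc] at hF
    obtain ⟨a, ha, hlim⟩ := ih _ hF
    refine ⟨a / ((m + 1 : ℕ) * ((m - 1 : ℕ) + 1)), by positivity, ?_⟩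
    have := tendsto_div_pow_of_add_eq (i := m + 1) (by omega)
      (g := fun n => ((PowerSeries.coeff n F : ℤ) : ℝ))
      (fun n => by
        have := coeff_add_of_mul_one_sub (F := F) (i := m + 1) rfl n
        exact_mod_cast this) hlim
    rwa [Nat.sub_add_cancel hm] at this

end Asymptotics

/-! ### Number of layers, and the profile -/

section Profile

open Classical

variable {E α X : Type*} [Fintype X] {t : Finset E → α} {π : E → X}

/-- The number of nonzero values of a vector of a span is at most the number of layers. -/
theorem IsLayerChain.card_image_erase_le {l : List (Finset X)} (hl : IsLayerChain l) {w : X → ℕ}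
    (hw : w ∈ layerSpan l) : ((Finset.univ.image w).erase 0).card ≤ l.length := by
  induction l generalizing w with
  | nil =>
    rw [Finset.card_eq_zero.2, List.length_nil]
    refine Finset.eq_empty_of_forall_notMem fun u hu => ?_
    obtain ⟨hu, hu'⟩ := Finset.mem_erase.1 hu
    obtain ⟨c, -, rfl⟩ := Finset.mem_image.1 hu'
    exact hu (eq_zero_of_mem_layerSpan hw (by simp))
  | cons S l ih =>
    obtain ⟨m, w, hw, rfl⟩ := hw
    have hsub : (Finset.univ.image (m • ind S + w)).erase 0 ⊆
        insert m (((Finset.univ.image w).erase 0).image (m + ·)) := by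
      intro u hu
      obtain ⟨hu, hu'⟩ := Finset.mem_erase.1 hu
      obtain ⟨c, -, rfl⟩ := Finset.mem_image.1 hu'
      by_cases hc : c ∈ S
      · by_cases hwc : w c = 0
        · exact Finset.mem_insert.2 (Or.inl (by simp [hwc, ind_of_mem hc]))
        · exact Finset.mem_insert_of_mem (Finset.mem_image.2 ⟨w c, by simp [hwc],
            by simp [ind_of_mem hc]⟩)
      · refine absurd (eq_zero_of_mem_layerSpan (l := S :: l) ⟨m, w, hw, rfl⟩ fun S' hS' => ?_) hu
        rcases List.mem_cons.1 hS' with rfl | hS'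
        · exact hc
        · exact fun h => hc (((List.pairwise_cons.1 hl.1).1 S' hS').subset h)
    calc _ ≤ _ := Finset.card_le_card hsub
      _ ≤ _ := Finset.card_insert_le _ _
      _ ≤ _ := Nat.add_le_add_right (Finset.card_image_le.trans (ih hl.of_cons hw)) 1

omit [Fintype X] in
/-- The layers of the canonical vectors consist of elements with infinite fibers. -/
theorem infinite_of_mem_layer {Ω : Set (X → ℕ)} (hΩ : ∀ v ∈ Ω, ∃ A, vec π A = v)
    {p : (X → ℕ) × List (Finset X)} (hp : piece p ⊆ Ω) {S : Finset X} (hS : S ∈ p.2) {c : X}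
    (hc : c ∈ S) : (π ⁻¹' {c}).Infinite := by
  intro hfin
  have hsmul : ∀ m : ℕ, m • ind S ∈ layerSpan p.2 := by
    intro m
    induction m with
    | zero => simpa using zero_mem_layerSpan p.2
    | succ m ih =>
      rw [succ_nsmul]
      exact add_mem_layerSpan ih (ind_mem_layerSpan hS)
  obtain ⟨A, hA⟩ := hΩ _ (hp ⟨_, hsmul (hfin.toFinset.card + 1), rfl⟩)
  have h₁ : vec π A c ≤ hfin.toFinset.card := by
    refine Finset.card_le_card fun x hx => ?_
    simpa using (Finset.mem_filter.1 hx).2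
  rw [hA] at h₁
  simp [ind_of_mem hc] at h₁
  omega

/-- A set of canonical vectors has a piece with as many layers as there are infinite fibers. -/
theorem exists_length_le (hπ : ∀ x y, π x = π y ↔ Interchangeable t Set.univ x y)
    (ht : IsHereditary t) (hsurj : Function.Surjective π) {Ω : Set (X → ℕ)}
    {P : Finset ((X → ℕ) × List (Finset X))} (hP : ∀ p ∈ P, IsLayerChain p.2)
    (hΩ : ∀ v ∈ Ω, ∃ p ∈ P, v ∈ piece p)
    (htΩ : ∀ A, ∃ v, v ∈ Ω ∧ ∃ B, vec π B = v ∧ t B = t A) :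
    ∃ p ∈ P, (Finset.univ.filter fun c => (π ⁻¹' {c}).Infinite).card ≤ p.2.length := by
  set K : Finset X := Finset.univ.filter fun c => (π ⁻¹' {c}).Infinite with hK
  have hKinf : ∀ c, c ∈ K ↔ (π ⁻¹' {c}).Infinite := fun c => by simp [hK]
  choose r hr using hsurj
  -- In any set containing `V`, interchangeability inside the set amounts to lying in the same
  -- fiber.
  obtain ⟨V, hrV, -, hV⟩ := exists_finset_interchangeable (t := t) (D := Set.univ)
    (U := Finset.univ.image r) (Set.subset_univ _)
  have hrV' : ∀ c, r c ∈ V := fun c => hrV (Finset.mem_image_of_mem r (Finset.mem_univ c))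
  have hfat : ∀ A : Finset E, V ⊆ A → ∀ x ∈ A, ∀ y ∈ A,
      Interchangeable t (A : Set E) x y → π x = π y := by
    intro A hVA x hx y hy h
    have huniv : ∀ z, Interchangeable t (A : Set E) (r (π z)) z := fun z =>
      ((hπ _ _).1 (hr _)).mono (Set.subset_univ _)
    have h₁ : Interchangeable t (A : Set E) (r (π x)) (r (π y)) :=
      ((huniv x).trans (hVA (hrV' _)) hy h).trans (hVA (hrV' _)) (hVA (hrV' _)) (huniv y).symm
    have h₂ := hV _ (Finset.mem_image_of_mem r (Finset.mem_univ _)) _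
      (Finset.mem_image_of_mem r (Finset.mem_univ _)) _ (Finset.coe_subset.2 hVA) h₁
    rwa [← hπ, hr, hr] at h₂
  -- a set with very different numbers of elements in the infinite fibers
  have hfin : (⋃ c ∈ {c : X | ¬ (π ⁻¹' {c}).Infinite}, π ⁻¹' {c}).Finite :=
    Set.Finite.biUnion (Set.toFinite _) fun c hc => Set.not_infinite.1 hc
  set β := ∑ p ∈ P, ∑ c, p.1 c with hβ
  have hβle : ∀ p ∈ P, ∀ c, p.1 c ≤ β := fun p hp c =>
    (Finset.single_le_sum (f := p.1) (fun _ _ => Nat.zero_le _) (Finset.mem_univ c)).trans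
      (Finset.single_le_sum (f := fun p : (X → ℕ) × List (Finset X) => ∑ c, p.1 c)
        (fun _ _ => Nat.zero_le _) hp)
  -- The values `d c` are at least `b` and differ pairwise by at least `b`. As `b > β`, subtracting
  -- offsets, whose entries are at most `β`, neither annihilates nor merges them; as `b ≥ V.card`,
  -- the difference `d c - vec π V c` is not truncated.
  set b := β + V.card + hfin.toFinset.card + 1 with hb
  let d : X → ℕ := fun c => b * ((Fintype.equivFin X c : ℕ) + 1)
  have hbd : ∀ c, b ≤ d c := fun c => Nat.le_mul_of_pos_right b (Nat.succ_pos _)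
  have hdd : ∀ c c', c ≠ c' → d c + b ≤ d c' ∨ d c' + b ≤ d c := by
    intro c c' hcc'
    have hne : (Fintype.equivFin X c : ℕ) ≠ Fintype.equivFin X c' := fun h =>
      hcc' ((Fintype.equivFin X).injective (Fin.ext h))
    rcases Nat.lt_or_gt_of_ne hne with h | h
    · left
      calc d c + b = b * ((Fintype.equivFin X c : ℕ) + 1 + 1) := by simp only [d]; ring
        _ ≤ _ := Nat.mul_le_mul_left b (by omega)
    · right
      calc d c' + b = b * ((Fintype.equivFin X c' : ℕ) + 1 + 1) := by simp only [d]; ring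
        _ ≤ _ := Nat.mul_le_mul_left b (by omega)
  obtain ⟨A, hVA, hA⟩ := exists_superset_vec_eq (π := π) V
    (fun c => if c ∈ K then d c - vec π V c else 0) (fun c hc => by
      rw [← hKinf]
      by_contra h
      simp [h] at hc)
  have hAd : ∀ c ∈ K, vec π A c = d c := by
    intro c hc
    have h₁ : vec π V c ≤ V.card := Finset.card_filter_le _ _
    have h₂ := hbd c
    rw [hA]
    simp only [Pi.add_apply, if_pos hc]
    omega
  obtain ⟨v, hvΩ, B, rfl, hBA⟩ := htΩ A
  obtain ⟨p, hp, w, hw, hpw⟩ := hΩ _ hvΩ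
  obtain ⟨f, hf, hfA, hft⟩ := ht B A hBA
  -- the induced permutation of the fibers
  have hfib : ∀ z ∈ B, ∀ z' ∈ B, π z = π z' → π (f z) = π (f z') := by
    intro z hz z' hz' h
    have h₁ : Interchangeable t (B : Set E) z z' := ((hπ _ _).1 h).mono (Set.subset_univ _)
    have h₂ := h₁.image hft hz hz'
    refine hfat A hVA _ (hfA ▸ Finset.mem_image_of_mem f hz) _
      (hfA ▸ Finset.mem_image_of_mem f hz') ?_
    rw [← hfA]
    simpa using h₂
  have hpre : ∀ c, ∃ z ∈ B, f z = r c := fun c => by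
    have := hVA (hrV' c)
    rw [← hfA] at this
    simpa using this
  choose z hzB hz using hpre
  -- `f` sends elements of one fiber to elements of one fiber and reaches every `r c`, so `ρ` is
  -- injective, hence a permutation, and transports the vector of `A` to that of `B`.
  let ρ : X → X := fun c => π (z c)
  have hρ : Function.Injective ρ := by
    intro c c' h
    have := hfib _ (hzB c) _ (hzB c') h
    rwa [hz, hz, hr, hr] at this
  have hρsurj := Finite.injective_iff_surjective.1 hρ
  have hvρ : ∀ c, vec π B (ρ c) = vec π A c := by
    intro c
    rw [← hfA, vec, vec, Finset.filter_image, Finset.card_image_of_injOn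
      (hf.mono (Finset.coe_subset.2 (Finset.filter_subset _ _)))]
    congr 1
    refine Finset.filter_congr fun x hx => ⟨fun h => ?_, fun h => ?_⟩
    · rw [hfib x hx _ (hzB c) h, hz, hr]
    · obtain ⟨c', hc'⟩ := hρsurj (π x)
      have := hfib x hx _ (hzB c') hc'.symm
      rw [hz, hr, h] at this
      rw [← hc', this]
  refine ⟨p, hp, le_trans ?_ ((hP p hp).card_image_erase_le hw)⟩
  have hwρ : ∀ c ∈ K, p.1 (ρ c) + w (ρ c) = d c := by
    intro c hc
    rw [← hAd c hc, ← hvρ, hpw]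
    rfl
  -- The span part `w` takes distinct nonzero values on `ρ(K)`, and it has at most as many nonzero
  -- values as layers.
  refine Finset.card_le_card_of_injOn (fun c => w (ρ c)) ?_ ?_
  · intro c hc
    have h₁ := hwρ c hc
    have h₂ := hβle p hp (ρ c)
    have h₃ := hbd c
    refine Finset.mem_coe.2 (Finset.mem_erase.2 ⟨?_, Finset.mem_image_of_mem w (Finset.mem_univ _)⟩)
    simp only
    omega
  · intro c hc c' hc' h
    by_contra hne
    have h₁ := hwρ c hc
    have h₂ := hwρ c' hc'
    have h₃ := hβle p hp (ρ c)
    have h₄ := hβle p hp (ρ c')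
    simp only at h
    rcases hdd c c' hne with h₅ | h₅ <;> omega

/-- The types of the sets of a given size are counted by the canonical vectors. -/
theorem typesOfCard_eq (ht : IsHereditary t) {Ω : Set (X → ℕ)}
    (hπ : ∀ x y, π x = π y ↔ Interchangeable t Set.univ x y)
    (hΩ : ∀ v ∈ Ω, ∃ A, vec π A = v)
    (htΩ : ∀ A, ∃! v, v ∈ Ω ∧ ∃ B, vec π B = v ∧ t B = t A) (n : ℕ) :
    (t '' {A : Finset E | A.card = n}).Finite ∧
      (t '' {A : Finset E | A.card = n}).ncard = sumCount Ω n := by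
  choose! F hF using hΩ
  have himage : t '' {A : Finset E | A.card = n} =
      (fun v => t (F v)) '' {v | v ∈ Ω ∧ ∑ c, v c = n} := by
    ext τ
    constructor
    · rintro ⟨A, hA, rfl⟩
      obtain ⟨v, ⟨hv, B, rfl, hBA⟩, -⟩ := htΩ A
      refine ⟨_, ⟨hv, ?_⟩, ?_⟩
      · rw [sum_vec, ht.card_eq hBA]
        exact hA
      · rw [← hBA]
        exact eq_of_vec_eq hπ (hF _ hv)
    · rintro ⟨v, ⟨hv, hn⟩, rfl⟩
      refine ⟨F v, ?_, rfl⟩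
      have := sum_vec (π := π) (F v)
      rw [hF v hv, hn] at this
      exact this.symm
  rw [himage]
  refine ⟨((finite_setOf_sum_eq n).subset fun v hv => hv.2).image _, ?_⟩
  refine Set.InjOn.ncard_image fun v hv w hw h => ?_
  exact (htΩ (F v)).unique ⟨hv.1, F v, hF v hv.1, rfl⟩ ⟨hw.1, F w, hF w hw.1, h.symm⟩

end Profile

/-! ### Monomorphic components as classes of interchangeable elements -/

section Components

open Classical FirstOrder

variable {L : FirstOrder.Language} [L.IsRelational] {E : Type*} [L.Structure E]

/-- The restriction of an isomorphism between induced structures. -/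
theorem isHereditary_isoType : IsHereditary (isoType L (E := E)) := by
  intro A B h
  obtain ⟨e⟩ : Nonempty (induced L (A : Set E) ≃[L] induced L (B : Set E)) := Quotient.exact h
  let f : E → E := fun x => if hx : x ∈ A then (e ⟨x, hx⟩ : E) else x
  have hf : ∀ x (hx : x ∈ A), f x = (e ⟨x, hx⟩ : E) := fun x hx => dif_pos hx
  have hinj : Set.InjOn f A := by
    intro x hx y hy hxy
    rw [hf x hx, hf y hy] at hxy
    exact congrArg Subtype.val (e.injective (Subtype.ext hxy))
  refine ⟨f, hinj, ?_, fun F hF => ?_⟩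
  · ext y
    rw [Finset.mem_image]
    constructor
    · rintro ⟨x, hx, rfl⟩
      rw [hf x hx]
      exact (e ⟨x, hx⟩).2
    · intro hy
      obtain ⟨⟨x, hx⟩, hxy⟩ := e.surjective ⟨y, hy⟩
      exact ⟨x, hx, by rw [hf x hx, hxy]⟩
  · refine Quotient.sound ⟨?_⟩
    have hmem : ∀ x : induced L (F : Set E), f x ∈ induced L ((F.image f : Finset E) : Set E) :=
      fun x => Finset.mem_coe.2 (Finset.mem_image_of_mem f x.2)
    let g : induced L (F : Set E) → induced L ((F.image f : Finset E) : Set E) :=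
      fun x => ⟨f x, hmem x⟩
    have hg : Function.Bijective g := by
      constructor
      · intro x y hxy
        exact Subtype.ext (hinj (hF x.2) (hF y.2) (congrArg Subtype.val hxy))
      · rintro ⟨y, hy⟩
        obtain ⟨x, hx, rfl⟩ := Finset.mem_image.1 (Finset.mem_coe.1 hy)
        exact ⟨⟨x, hx⟩, rfl⟩
    refine ⟨Equiv.ofBijective g hg, ?_, ?_⟩
    · intro n φ
      exact isEmptyElim φ
    · intro n ρ x
      have := e.map_rel ρ (fun i => ⟨x i, hF (x i).2⟩)
      have hfx : (fun i => ((e ⟨x i, hF (x i).2⟩ : induced L (B : Set E)) : E)) =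
          fun i => f (x i) := funext fun i => (hf _ _).symm
      change FirstOrder.Language.Structure.RelMap ρ (fun i => f (x i)) ↔
        FirstOrder.Language.Structure.RelMap ρ (fun i => (x i : E))
      rw [← hfx]
      exact this

variable (L) in
/-- The class of an element for the interchangeability relation. -/
def interchangeClass (x : E) : Set E := {y | Interchangeable (isoType L) Set.univ x y}

theorem interchangeClass_eq_iff {x y : E} :
    interchangeClass L x = interchangeClass L y ↔
      Interchangeable (isoType L) Set.univ x y := by
  constructor
  · intro h
    have : y ∈ interchangeClass L y := Interchangeable.refl _ _ _
    rwa [← h] at this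
  · intro h
    ext z
    exact ⟨fun hz => h.symm.trans trivial trivial hz, fun hz => h.trans trivial trivial hz⟩

theorem IsMonomorphicPart.interchangeable {V : Set E} (hV : IsMonomorphicPart L V) {x y : E}
    (hx : x ∈ V) (hy : y ∈ V) : Interchangeable (isoType L) Set.univ x y := by
  intro F _ hxF hyF
  refine hV _ _ ?_ ?_
  · rw [Finset.card_insert_of_notMem hxF, Finset.card_insert_of_notMem hyF]
  · rw [Finset.coe_insert, Finset.coe_insert, Set.insert_sdiff_of_mem _ hx,
      Set.insert_sdiff_of_mem _ hy]

/-- Sets of equal size that agree outside the class have as many elements in it, hence equally many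
in every class. -/
theorem isMonomorphicPart_interchangeClass (x : E) :
    IsMonomorphicPart L (interchangeClass L x) := by
  intro A B hcard hdiff
  have hdiff' : ∀ y, y ∉ interchangeClass L x → (y ∈ A ↔ y ∈ B) := by
    intro y hy
    have := Set.ext_iff.1 hdiff y
    simpa [hy] using this
  refine eq_of_card_filter_interchangeable (D := Set.univ) (Set.subset_univ _)
    (Set.subset_univ _) fun z _ => ?_
  by_cases hz : z ∈ interchangeClass L x
  · have hzx : ∀ y, Interchangeable (isoType L) Set.univ z y ↔ y ∈ interchangeClass L x :=
      fun y => ⟨fun h => hz.trans trivial trivial h, fun h => hz.symm.trans trivial trivial h⟩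
    simp only [hzx]
    have hA := Finset.card_filter_add_card_filter_not (s := A) (· ∈ interchangeClass L x)
    have hB := Finset.card_filter_add_card_filter_not (s := B) (· ∈ interchangeClass L x)
    have hAB : A.filter (fun y => ¬ y ∈ interchangeClass L x) =
        B.filter (fun y => ¬ y ∈ interchangeClass L x) := by
      ext y
      simp only [Finset.mem_filter]
      exact ⟨fun h => ⟨(hdiff' y h.2).1 h.1, h.2⟩, fun h => ⟨(hdiff' y h.2).2 h.1, h.2⟩⟩
    rw [hAB] at hA
    omega
  · congr 1
    ext y
    simp only [Finset.mem_filter]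
    have : Interchangeable (isoType L) Set.univ z y → y ∉ interchangeClass L x :=
      fun h hy => hz (hy.trans trivial trivial h.symm)
    exact ⟨fun h => ⟨(hdiff' y (this h.2)).1 h.1, h.2⟩, fun h => ⟨(hdiff' y (this h.2)).2 h.1, h.2⟩⟩

/-- Maximality holds because the elements of a monomorphic part are pairwise interchangeable. -/
theorem isMonomorphicComponent_interchangeClass (x : E) :
    IsMonomorphicComponent L (interchangeClass L x) :=
  ⟨isMonomorphicPart_interchangeClass x, fun _ hV hle _ hy =>
    hV.interchangeable (hle (Interchangeable.refl _ _ x)) hy⟩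

/-- On an empty domain the empty set would be a component, hence `Nonempty E`. -/
theorem IsMonomorphicComponent.eq_interchangeClass [Nonempty E] {C : Set E}
    (hC : IsMonomorphicComponent L C) : C.Nonempty ∧ ∀ x ∈ C, C = interchangeClass L x := by
  have key : ∀ x, C ⊆ interchangeClass L x → C = interchangeClass L x := fun x h =>
    h.antisymm (hC.2 (isMonomorphicPart_interchangeClass x) h)
  refine ⟨?_, fun x hx => key x fun y hy => hC.1.interchangeable hx hy⟩
  by_contra h
  rw [Set.not_nonempty_iff_eq_empty] at h
  obtain ⟨x⟩ := ‹Nonempty E›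
  have hx : x ∈ interchangeClass L x := Interchangeable.refl _ _ x
  rw [← key x (by rw [h]; exact Set.empty_subset _), h] at hx
  exact hx

variable (L) in
/-- The component of an element. -/
def componentOf (x : E) : Component L E :=
  ⟨interchangeClass L x, isMonomorphicComponent_interchangeClass x⟩

theorem componentOf_eq_iff (x y : E) :
    componentOf L x = componentOf L y ↔ Interchangeable (isoType L) Set.univ x y := by
  rw [← interchangeClass_eq_iff]
  exact Subtype.ext_iff

theorem componentOf_eq_iff_mem [Nonempty E] {x : E} {C : Component L E} :
    componentOf L x = C ↔ x ∈ C.1 := by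
  constructor
  · rintro rfl
    exact Interchangeable.refl _ _ x
  · intro hx
    exact Subtype.ext (C.2.eq_interchangeClass.2 x hx).symm

theorem componentOf_surjective [Nonempty E] :
    Function.Surjective (componentOf L : E → Component L E) := by
  intro C
  obtain ⟨x, hx⟩ := C.2.eq_interchangeClass.1
  exact ⟨x, componentOf_eq_iff_mem.2 hx⟩

theorem preimage_componentOf [Nonempty E] (C : Component L E) :
    componentOf L ⁻¹' {C} = C.1 :=
  Set.ext fun _ => componentOf_eq_iff_mem

theorem vec_componentOf [Nonempty E] (A : Finset E) (C : Component L E) :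
    vec (componentOf L) A C = ((A : Set E) ∩ C.1).ncard := by
  rw [vec, ← Set.ncard_coe_finset]
  congr 1
  ext x
  simp [componentOf_eq_iff_mem]

variable (L E) in
theorem isMonomorphicDecomposition_components [Nonempty E] :
    IsMonomorphicDecomposition L {C : Set E | IsMonomorphicComponent L C} := by
  refine ⟨⟨fun h => ?_, fun x => ⟨interchangeClass L x,
    ⟨isMonomorphicComponent_interchangeClass x, Interchangeable.refl _ _ x⟩, ?_⟩⟩, ?_⟩
  · exact Set.not_nonempty_empty (IsMonomorphicComponent.eq_interchangeClass h).1
  · rintro C ⟨hC, hx⟩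
    exact IsMonomorphicComponent.eq_interchangeClass hC |>.2 x hx
  · intro A B h
    refine eq_of_vec_eq (π := componentOf L) componentOf_eq_iff (funext fun C => ?_)
    rw [vec_componentOf, vec_componentOf, h C.1 C.2]

theorem IsMonomorphicDecomposition.interchangeable {P : Set (Set E)}
    (hP : IsMonomorphicDecomposition L P) {B : Set E} (hB : B ∈ P) {x y : E} (hx : x ∈ B)
    (hy : y ∈ B) : Interchangeable (isoType L) Set.univ x y := by
  intro F _ hxF hyF
  refine hP.2 _ _ fun B' hB' => ?_
  rw [Finset.coe_insert, Finset.coe_insert]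
  by_cases hBB' : B' = B
  · subst hBB'
    have hfin : ((F : Set E) ∩ B').Finite := F.finite_toSet.inter_of_left _
    rw [Set.insert_inter_of_mem hx, Set.insert_inter_of_mem hy,
      Set.ncard_insert_of_notMem (fun h => hxF h.1) hfin,
      Set.ncard_insert_of_notMem (fun h => hyF h.1) hfin]
  · have hx' : x ∉ B' := fun h => hBB' ((hP.1.2 x).unique ⟨hB', h⟩ ⟨hB, hx⟩)
    have hy' : y ∉ B' := fun h => hBB' ((hP.1.2 y).unique ⟨hB', h⟩ ⟨hB, hy⟩)
    rw [Set.insert_inter_of_notMem hx', Set.insert_inter_of_notMem hy']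

theorem IsMonomorphicDecomposition.exists_component {P : Set (Set E)}
    (hP : IsMonomorphicDecomposition L P) {B : Set E} (hB : B ∈ P) :
    ∃ C, IsMonomorphicComponent L C ∧ B ⊆ C := by
  have hne : B.Nonempty := Set.nonempty_iff_ne_empty.2 fun h => hP.1.1 (h ▸ hB)
  obtain ⟨x, hx⟩ := hne
  exact ⟨_, isMonomorphicComponent_interchangeClass x, fun y hy => hP.interchangeable hB hx hy⟩

theorem finite_components [Nonempty E] {P : Set (Set E)} (hfin : P.Finite)
    (hP : IsMonomorphicDecomposition L P) : {C : Set E | IsMonomorphicComponent L C}.Finite := by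
  have hex : ∀ B : Set E, ∃ C : Set E, B ∈ P → IsMonomorphicComponent L C ∧ B ⊆ C := by
    intro B
    by_cases hB : B ∈ P
    · obtain ⟨C, hC⟩ := hP.exists_component hB
      exact ⟨C, fun _ => hC⟩
    · exact ⟨∅, fun h => absurd h hB⟩
  choose g hg using hex
  -- Each component contains a point of some block and is therefore the component containing that
  -- block.
  refine (hfin.image g).subset fun C hC => ?_
  obtain ⟨hne, hCx⟩ := IsMonomorphicComponent.eq_interchangeClass hC
  obtain ⟨x, hx⟩ := hne
  obtain ⟨B, ⟨hB, hxB⟩, -⟩ := hP.1.2 x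
  obtain ⟨h₁, h₂⟩ := hg B hB
  exact ⟨B, hB, by rw [hCx x hx, h₁.eq_interchangeClass.2 x (h₂ hxB)]⟩

theorem one_le_ncard_infinite_components [Infinite E]
    (hfin : {C : Set E | IsMonomorphicComponent L C}.Finite) :
    1 ≤ {C : Set E | IsMonomorphicComponent L C ∧ C.Infinite}.ncard := by
  rw [Nat.one_le_iff_ne_zero]
  intro h
  rw [Set.ncard_eq_zero (hfin.subset fun C hC => hC.1)] at h
  refine Set.infinite_univ (α := E) ((hfin.sUnion fun C hC => ?_).subset fun x _ =>
    Set.mem_sUnion.2 ⟨interchangeClass L x, isMonomorphicComponent_interchangeClass x,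
      Interchangeable.refl (isoType L) Set.univ x⟩)
  by_contra hinf
  exact Set.eq_empty_iff_forall_notMem.1 h C ⟨hC, hinf⟩

theorem codes_iff [Nonempty E] {w : List (Component L E)} {τ : Age L E} :
    Codes w τ ↔ ∃ A : Finset E, vec (componentOf L) A = countVec w ∧ isoType L A = τ := by
  refine exists_congr fun A => and_congr_left fun _ => ?_
  rw [funext_iff]
  refine forall_congr' fun C => ?_
  rw [vec_componentOf, eq_comm]
  simp only [countVec]
  congr!

end Components

end RelationalStructure

end

/-! ### The theorem -/

theorem mainTheorem7 (L : FirstOrder.Language) [L.IsRelational] (E : Type*) [L.Structure E]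
    [Infinite E]
    (hR : ∃ P : Set (Set E), P.Finite ∧ RelationalStructure.IsMonomorphicDecomposition L P)
    (k : ℕ)
    (hk : k = {C : Set E | RelationalStructure.IsMonomorphicComponent L C ∧ C.Infinite}.ncard) :
    -- the components form a finite monomorphic decomposition, coarser than any other one
    ({C : Set E | RelationalStructure.IsMonomorphicComponent L C}.Finite ∧
      RelationalStructure.IsMonomorphicDecomposition L
        {C : Set E | RelationalStructure.IsMonomorphicComponent L C} ∧
      (∀ P : Set (Set E), RelationalStructure.IsMonomorphicDecomposition L P →
        ∀ B ∈ P, ∃ C : Set E, RelationalStructure.IsMonomorphicComponent L C ∧ B ⊆ C) ∧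
      1 ≤ k) ∧
    RelationalStructure.AgeIsRational L E ∧
    (∀ n : ℕ, (RelationalStructure.typesOfSize L E n).Finite) ∧
    (∃ P : ℤ[X], P.eval 1 ≠ 0 ∧
      PowerSeries.mk (fun n => (RelationalStructure.profile L E n : ℤ)) *
        ∏ i ∈ Finset.Icc 1 k, (1 - (PowerSeries.X : ℤ⟦X⟧) ^ i) = (P : ℤ⟦X⟧)) ∧
    (∃ a : ℝ, 0 < a ∧
      Tendsto (fun n : ℕ => (RelationalStructure.profile L E n : ℝ) / (n : ℝ) ^ (k - 1))
        atTop (𝓝 a)) := by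
  classical
  open RelationalStructure in
  obtain ⟨P₀, hP₀fin, hP₀⟩ := hR
  have hfin := finite_components hP₀fin hP₀
  have hk1 : 1 ≤ k := hk ▸ one_le_ncard_infinite_components hfin
  have : Finite (Component L E) := hfin
  let _ : Fintype (Component L E) := Fintype.ofFinite _
  have hπ := componentOf_eq_iff (L := L) (E := E)
  have ht := isHereditary_isoType (L := L) (E := E)
  have hcard : (Finset.univ.filter fun C : Component L E =>
      (componentOf L ⁻¹' {C}).Infinite).card = k := by
    rw [hk, ← Set.ncard_coe_finset, ← Set.ncard_image_of_injective _ Subtype.val_injective]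
    congr 1
    ext C
    simp [preimage_componentOf, and_comm]
  obtain ⟨Ω, hΩ, hreal, huniq⟩ := exists_canonical_vectors hπ ht
  have hprofile := typesOfCard_eq ht hπ hreal huniq
  have hseries : PowerSeries.mk (fun n => (profile L E n : ℤ)) = sumSeries Ω := by
    ext n
    rw [sumSeries, PowerSeries.coeff_mk, PowerSeries.coeff_mk, ← (hprofile n).2]
    rfl
  obtain ⟨W, hW, hWΩ, hWu⟩ := hΩ.exists_isRegular
  obtain ⟨P, hP, hPΩ, hPu⟩ := hΩ
  -- Layers consist of infinite components only, since a piece has unbounded entries on them; hence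
  -- the bound `k`.
  have hPk : ∀ p ∈ P, ∀ S ∈ p.2, S.card ≤ k := fun p hp S hS => by
    rw [← hcard]
    exact Finset.card_le_card fun C hC => by
      simpa using infinite_of_mem_layer hreal (hPΩ p hp) hS hC
  have hrat := sumSeries_mul_prod hP hPk hPΩ hPu
  obtain ⟨p, hp, hlen⟩ := exists_length_le hπ ht componentOf_surjective hP
    (fun v hv => (hPu v hv).exists) fun A => (huniq A).exists
  rw [hcard] at hlen
  have hpos := numerator_eval_pos hp (hP p hp) (hPk p hp) hlen
  refine ⟨⟨hfin, isMonomorphicDecomposition_components L E,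
    fun Q hQ B hB => hQ.exists_component hB, hk1⟩, ⟨W, hW, fun w hw => ?_, fun τ => ?_⟩,
    fun n => (hprofile n).1, ⟨_, hpos.ne', by rw [hseries, hrat]⟩, ?_⟩
  · obtain ⟨A, hA⟩ := hreal _ (hWΩ w hw)
    refine ⟨isoType L A, codes_iff.2 ⟨A, hA, rfl⟩, fun τ hτ => ?_⟩
    obtain ⟨B, hB, rfl⟩ := codes_iff.1 hτ
    -- A word codes a single type because the vector determines the type.
    exact eq_of_vec_eq hπ (hB.trans hA.symm)
  · obtain ⟨A, rfl⟩ : ∃ A, isoType L A = τ := Quotient.exists_rep τ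
    obtain ⟨v, ⟨hv, B, hB, hBA⟩, hvu⟩ := huniq A
    obtain ⟨w, ⟨hw, hwv⟩, hwu⟩ := hWu v hv
    refine ⟨w, ⟨hw, codes_iff.2 ⟨B, hB.trans hwv.symm, hBA⟩⟩, ?_⟩
    rintro w' ⟨hw', hcode⟩
    obtain ⟨B', hB', hBA'⟩ := codes_iff.1 hcode
    exact hwu w' ⟨hw', hvu _ ⟨hWΩ w' hw', B', hB', hBA'⟩⟩
  · obtain ⟨a, ha, hlim⟩ := exists_tendsto_coeff_div_pow hk1 hpos _ hrat
    refine ⟨a, ha, hlim.congr fun n => ?_⟩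
    rw [← hseries, PowerSeries.coeff_mk, Int.cast_natCast]
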